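/- Let $k\ge 2$. There is a constant $C>0$ depending only on $k$ such that the following holds. Let $\mu$ be a $\sigma$-finite non-atomic measure on a measurable space $(X,\mathcal X)$, and let $\mu_W$ be a white noise with reference measure $\mu$, i.e. a jointly Gaussian family $\mu_W(B)$ ($B\in\mathcal X$, $\mu(B)<\infty$) with $E\mu_W(B)=0$ and $E\mu_W(A)\mu_W(B)=\mu(A\cap B)$. Let $f(x_1,\dots,x_k)$ be a real measurable function on $X^k$ with $\int f^2\,d\mu^k<\infty$, and let $$I_k(f)=\frac1{k!}\int f(x_1,\dots,x_k)\,\mu_W(dx_1)\cdots\mu_W(dx_k)$$ be its $k$-fold Wiener–Itô integral. For a partition $P=\{A_1,\dots,A_s\}$ of $\{1,\dots,k\}$ into non-empty sets put $$V_P(f)=\sup\int f(x_1,\dots,x_k)\prod_{r=1}^s g_r(x_j,\,j\in A_r)\,\mu(dx_1)\cdots\mu(dx_k),$$ where the supremum is over all measurable functions $g_1,\dots,g_s$ with $\int g_r^2(x_j,\,j\in A_r)\prod_{j\in A_r}\mu(dx_j)\le 1$ for all $1\le r\le s$, and let $V_s(f)=\sup V_P(f)$ over all partitions $P$ of $\{1,\dots,k\}$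 into exactly $s$ non-empty sets. Let $M$ be a positive integer and $R$ a real number such that $0\le R\le1$, $$V_s(f)\le R^{s-1}\quad\text{for all }1\le s\le k,\qquad\text{and}\qquad R\ge M^{-(k-1)/2}.$$ Then $(k!\,I_k(f))^{2M}$ is integrable and $$E\bigl(k!\,I_k(f)\bigr)^{2M}\le C^M M^{kM}R^{2M}.$$ -/

import Mathlib

open MeasureTheory ProbabilityTheory

noncomputable section

namespace WienerIto

/-- A measure is non-atomic if every measurable set of positive measure has a measurable subset
of strictly smaller positive measure. (This is stronger than points having measure zero.) -/
def IsNonatomic {X : Type*} [MeasurableSpace X] (μ : Measure X) : Prop :=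
  ∀ A : Set X, MeasurableSet A → 0 < μ A → ∃ B ⊆ A, MeasurableSet B ∧ 0 < μ B ∧ μ B < μ A

/-- The measurable sets of finite `μ`-measure, the index set of a white noise. -/
abbrev FiniteMeasureSet {X : Type*} [MeasurableSpace X] (μ : Measure X) : Type _ :=
  {B : Set X // MeasurableSet B ∧ μ B < ⊤}

/-- `W` is a white noise with reference measure `μ` on the probability space `(Ω, P)`: a jointly
Gaussian family indexed by the measurable sets of finite `μ`-measure, with mean zero and with
`E W(A) W(B) = μ (A ∩ B)`. -/
structure IsWhiteNoise {X Ω : Type*} [MeasurableSpace X] [MeasurableSpace Ω]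
    (μ : Measure X) (P : Measure Ω) (W : FiniteMeasureSet μ → Ω → ℝ) : Prop where
  gaussian : IsGaussianProcess W P
  mean_zero : ∀ A, ∫ ω, W A ω ∂P = 0
  covariance : ∀ A B, ∫ ω, W A ω * W B ω ∂P = (μ ((A : Set X) ∩ (B : Set X))).toReal

/-- The data of an elementary kernel of `k` variables: finitely many pairwise disjoint measurable
sets `A 0, …, A (n - 1)` of finite measure and coefficients `c i₁ … i_k` that vanish unless the
indices `i₁, …, i_k` are pairwise different. -/
structure ElementaryKernel {X : Type*} [MeasurableSpace X] (μ : Measure X) (k : ℕ) where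
  n : ℕ
  A : Fin n → FiniteMeasureSet μ
  disjoint : ∀ i j, i ≠ j → Disjoint (A i : Set X) (A j : Set X)
  c : (Fin k → Fin n) → ℝ
  c_diag : ∀ i, ¬ Function.Injective i → c i = 0

/-- The function `∑ c i₁ … i_k 1_{A i₁}(x₁) ⋯ 1_{A i_k}(x_k)` given by an elementary kernel. -/
def ElementaryKernel.toFun {X : Type*} [MeasurableSpace X] {μ : Measure X} {k : ℕ}
    (φ : ElementaryKernel μ k) (x : Fin k → X) : ℝ :=
  ∑ i : Fin k → Fin φ.n, φ.c i * ∏ l, Set.indicator (φ.A (i l) : Set X) (fun _ => (1 : ℝ)) (x l)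

/-- The integral `I_k(φ) = (1 / k!) ∑ c i₁ … i_k W(A i₁) ⋯ W(A i_k)` of an elementary kernel. -/
def ElementaryKernel.integral {X Ω : Type*} [MeasurableSpace X] {μ : Measure X} {k : ℕ}
    (φ : ElementaryKernel μ k) (W : FiniteMeasureSet μ → Ω → ℝ) (ω : Ω) : ℝ :=
  (1 / (k.factorial : ℝ)) * ∑ i : Fin k → Fin φ.n, φ.c i * ∏ l, W (φ.A (i l)) ω

/-- The random variable `Y` is (a version of) the `k`-fold Wiener–Itô integral
`I_k(f) = (1 / k!) ∫ f(x₁, …, x_k) W(dx₁) ⋯ W(dx_k)`: the pair `(f, Y)` is the limit, in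
`L²(μᵏ)` and `L²(P)` respectively, of elementary kernels and their integrals. -/
def IsWienerItoIntegral {X Ω : Type*} [MeasurableSpace X] [MeasurableSpace Ω]
    {μ : Measure X} (P : Measure Ω) (W : FiniteMeasureSet μ → Ω → ℝ) {k : ℕ}
    (f : (Fin k → X) → ℝ) (Y : Ω → ℝ) : Prop :=
  MemLp Y 2 P ∧ ∃ φ : ℕ → ElementaryKernel μ k,
    Filter.Tendsto (fun m => eLpNorm (fun x => (φ m).toFun x - f x) 2
      (Measure.pi fun _ : Fin k => μ)) Filter.atTop (nhds 0) ∧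
    Filter.Tendsto (fun m => eLpNorm (fun ω => (φ m).integral W ω - Y ω) 2 P)
      Filter.atTop (nhds 0)

/-- The class `F_P` for a partition `P` of the finite set `K`: the families of measurable
functions `g_A(x_j, j ∈ A)`, one for each block `A` of `P`, with `∫ g_A² dμ^A ≤ 1`. -/
def blockFunctions {X : Type*} [MeasurableSpace X] (μ : Measure X) {K : Type*} [Fintype K]
    [DecidableEq K] (P : Finpartition (Finset.univ : Finset K)) :
    Set ((A : {A : Finset K // A ∈ P.parts}) → ({j : K // j ∈ A.1} → X) → ℝ) :=
  {g | ∀ A, Measurable (g A) ∧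
    ∫⁻ x, ENNReal.ofReal (g A x ^ 2) ∂(Measure.pi fun _ : {j : K // j ∈ A.1} => μ) ≤ 1}

/-- `V_P(f)`, the supremum over `(g_A) ∈ F_P` of `∫ f(x) ∏_A g_A(x_j, j ∈ A) ∏_j μ(dx_j)`. The
supremum is taken in the extended reals. -/
def VP {X : Type*} [MeasurableSpace X] (μ : Measure X) {K : Type*} [Fintype K] [DecidableEq K]
    (f : (K → X) → ℝ) (P : Finpartition (Finset.univ : Finset K)) : EReal :=
  ⨆ g ∈ blockFunctions μ P,
    ((∫ x, f x * ∏ A : {A : Finset K // A ∈ P.parts}, g A (fun j => x j.1)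
      ∂(Measure.pi fun _ : K => μ) : ℝ) : EReal)

/-- `V_s(f)`, the supremum of `V_P(f)` over the partitions `P` of `K` into exactly `s` non-empty
sets. -/
def V {X : Type*} [MeasurableSpace X] (μ : Measure X) {K : Type*} [Fintype K] [DecidableEq K]
    (s : ℕ) (f : (K → X) → ℝ) : EReal :=
  ⨆ (P : Finpartition (Finset.univ : Finset K)) (_ : P.parts.card = s), VP μ f P

end WienerIto

end

/-! After approximation by elementary kernels and normalization of the sets, the integral becomes a
Gaussian polynomial F(g) = ∑ c(i) g(i₁)⋯g(i_k) whose coefficients vanish on multi-indices with a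
repetition. Two quantities control its moments: the Hilbert–Schmidt norm of c, which V₁ bounds, and
the largest operator norm ρ of a matrix obtained by splitting the legs of c into two nonempty
classes, which V₂ bounds (`ElementaryKernel.hasBlockBounds`).

Averaging over colorings of the variables by k colors replaces F by multilinear forms in k
independent Gaussian vectors (`chaosPoly_pow_le`, `contract_colored`). These vectors are integrated
out one by one. The first turns the 2M-th power of a linear form into (3M)^M times the 2M-th power
of the norm of a random vector. If such a vector is ∑ x_a B_a with x Gaussian,
`lintegral_norm_pow_le` leaves two terms: either the leg a joins the coordinates, at no cost in
powers of M, or the vector becomes the matrix B, at cost (4M)^M, with tr (B Bᵀ)^M in place of a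
norm. For matrices the noncommutative Khintchine inequality `integral_trace_pow_le` moves each
further leg to the rows or to the columns, at cost (16M)^M. When no leg is left, tr (B Bᵀ)^M ≤
ρ^(2(M-1)) tr (B Bᵀ) ≤ ρ^(2(M-1)). The dimension never enters, because the Hilbert–Schmidt norm
supplies the one remaining trace.

The outcome is E F^(2M) ≤ C^M M^M (1 + M^((k-1)M) ρ^(2(M-1))). The lower bound on R says M^(k-1) R²
≥ 1. This absorbs the summand 1, and it restores the missing factor R² at the price M^(k-1) ≤
2^((k-1)M) (`momentBound_le`). -/

noncomputable section

namespace WienerIto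

/-! ### Gaussian integration by parts for polynomials -/

section

/-- The standard Gaussian measure on `J → ℝ`. -/
abbrev stdGauss (J : Type*) [Fintype J] : Measure (J → ℝ) :=
  Measure.pi fun _ : J => gaussianReal 0 1

lemma integrable_pow_gaussianReal (n : ℕ) :
    Integrable (fun x : ℝ => x ^ n) (gaussianReal 0 1) := by
  have h := (memLp_id_gaussianReal (μ := 0) (v := 1) (n : NNReal)).integrable_norm_pow'
  refine (integrable_norm_iff (by fun_prop)).1 ?_
  simpa [norm_pow] using h

lemma hasDerivAt_gaussianPDFReal (x : ℝ) :
    HasDerivAt (gaussianPDFReal 0 1) (-x * gaussianPDFReal 0 1 x) x := by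
  have h : HasDerivAt (fun x : ℝ => (Real.sqrt (2 * Real.pi * (1 : NNReal)))⁻¹ *
      Real.exp (-(x - 0) ^ 2 / (2 * (1 : NNReal)))) 
      ((Real.sqrt (2 * Real.pi * (1 : NNReal)))⁻¹ *
      (Real.exp (-(x - 0) ^ 2 / (2 * (1 : NNReal))) * (-x))) x := by
    refine HasDerivAt.const_mul _ (HasDerivAt.exp ?_)
    have := (((hasDerivAt_id x).sub_const 0).pow 2).neg.div_const (2 * ((1 : NNReal) : ℝ))
    refine this.congr_deriv ?_
    simp
    ring
  have e : gaussianPDFReal 0 1 = (fun x : ℝ => (Real.sqrt (2 * Real.pi * (1 : NNReal)))⁻¹ *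
      Real.exp (-(x - 0) ^ 2 / (2 * (1 : NNReal)))) := rfl
  rw [e]
  refine h.congr_deriv ?_
  ring


/-- Integration by parts against the density φ, using φ' = -xφ. For n = 0 the truncated exponent is
harmless, since its coefficient is 0. -/
lemma integral_mul_pow_gaussianReal (n : ℕ) :
    ∫ x, x ^ (n + 1) ∂gaussianReal 0 1 = n * ∫ x, x ^ (n - 1) ∂gaussianReal 0 1 := by
  have key : ∀ m : ℕ, Integrable (fun x => x ^ m * gaussianPDFReal 0 1 x) := by
    intro m
    have := integrable_pow_gaussianReal m
    rw [gaussianReal_of_var_ne_zero _ one_ne_zero, gaussianPDF_def,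
      integrable_withDensity_iff (by fun_prop) (by simp)] at this
    refine this.congr (Filter.Eventually.of_forall fun x => ?_)
    simp [ENNReal.toReal_ofReal (gaussianPDFReal_nonneg 0 1 x)]
  have h := integral_mul_deriv_eq_deriv_mul_of_integrable
    (u := fun x : ℝ => x ^ n) (v := gaussianPDFReal 0 1)
    (u' := fun x => (n : ℝ) * x ^ (n - 1)) (v' := fun x => -x * gaussianPDFReal 0 1 x)
    (fun x _ => hasDerivAt_pow n x) (fun x _ => hasDerivAt_gaussianPDFReal x)
    ?_ ?_ ?_
  · rw [integral_gaussianReal_eq_integral_smul one_ne_zero,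
      integral_gaussianReal_eq_integral_smul one_ne_zero, ← integral_const_mul]
    simp only [smul_eq_mul]
    have e1 : ∀ x : ℝ, gaussianPDFReal 0 1 x * x ^ (n + 1) =
      -(x ^ n * (-x * gaussianPDFReal 0 1 x)) := fun x => by ring
    simp_rw [e1]
    rw [integral_neg, h, neg_neg]
    refine integral_congr_ae (Filter.Eventually.of_forall fun x => ?_)
    simp only
    ring
  · refine (key (n + 1)).neg.congr (Filter.Eventually.of_forall fun x => ?_)
    simp [pow_succ]; ring
  · refine ((key (n - 1)).const_mul n).congr (Filter.Eventually.of_forall fun x => ?_)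
    simp; ring
  · exact (key n)

variable {J : Type*} [Fintype J]

lemma integrable_eval_stdGauss (p : MvPolynomial J ℝ) :
    Integrable (fun x => MvPolynomial.eval x p) (stdGauss J) := by
  induction p using MvPolynomial.induction_on' with
  | monomial m a =>
    simp only [MvPolynomial.eval_monomial]
    refine Integrable.const_mul ?_ a
    simp_rw [Finsupp.prod_fintype m _ (fun _ => pow_zero _)]
    exact Integrable.fintype_prod (fun j => integrable_pow_gaussianReal (m j))
  | add p q hp hq =>
    simp only [map_add]
    exact hp.add hq

/-- By linearity a monomial suffices; there the integral factorizes and only coordinate i changes.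
With polynomials, every integrability condition is automatic. -/
lemma integral_X_mul_eval_stdGauss (i : J) (p : MvPolynomial J ℝ) :
    ∫ x, x i * MvPolynomial.eval x p ∂stdGauss J =
      ∫ x, MvPolynomial.eval x (MvPolynomial.pderiv i p) ∂stdGauss J := by
  classical
  induction p using MvPolynomial.induction_on' with
  | monomial m a =>
    rw [MvPolynomial.pderiv_monomial]
    simp only [MvPolynomial.eval_monomial]
    simp_rw [Finsupp.prod_fintype _ _ (fun _ => pow_zero _)]
    have e1 : ∀ x : J → ℝ, x i * (a * ∏ j, x j ^ m j) =
        a * ∏ j, x j ^ (m j + if j = i then 1 else 0) := by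
      intro x
      simp_rw [pow_add, Finset.prod_mul_distrib]
      have : ∏ j, x j ^ (if j = i then 1 else 0) = x i := by
        simp [pow_ite]
      rw [this]; ring
    simp_rw [e1]
    rw [integral_const_mul, integral_const_mul,
      integral_fintype_prod_eq_prod (fun j (t : ℝ) => t ^ (m j + if j = i then 1 else 0)),
      integral_fintype_prod_eq_prod (fun j (t : ℝ) => t ^ ((m - Finsupp.single i 1 : J →₀ ℕ) j)),
      ← Finset.mul_prod_erase _ _ (Finset.mem_univ i),
      ← Finset.mul_prod_erase _ _ (Finset.mem_univ i), if_pos rfl, integral_mul_pow_gaussianReal]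
    have e2 : ∏ j ∈ Finset.univ.erase i, ∫ t : ℝ, t ^ (m j + if j = i then 1 else 0)
          ∂gaussianReal 0 1 = ∏ j ∈ Finset.univ.erase i,
          ∫ t : ℝ, t ^ ((m - Finsupp.single i 1 : J →₀ ℕ) j) ∂gaussianReal 0 1 := by
      refine Finset.prod_congr rfl fun j hj => ?_
      have hji : j ≠ i := Finset.ne_of_mem_erase hj
      simp [hji]
    rw [e2]
    simp
    ring
  | add p q hp hq =>
    have h : ∀ r : MvPolynomial J ℝ,
        Integrable (fun x => x i * MvPolynomial.eval x r) (stdGauss J) := fun r => by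
      have := integrable_eval_stdGauss (MvPolynomial.X i * r)
      simp only [map_mul, MvPolynomial.eval_X] at this
      exact this
    simp only [map_add, mul_add]
    rw [integral_add (h p) (h q), integral_add (integrable_eval_stdGauss _)
      (integrable_eval_stdGauss _), hp, hq]

end

/-! ### Trace inequalities for symmetric matrices -/

section

open Matrix

variable {n : Type*} [Fintype n] [DecidableEq n]

lemma exists_orthogonal_diagonalization {X : Matrix n n ℝ} (hX : X.IsSymm) :
    ∃ (U : Matrix n n ℝ) (d : n → ℝ), Uᵀ * U = 1 ∧ U * Uᵀ = 1 ∧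
      ∀ l : ℕ, X ^ l = U * diagonal (fun i => d i ^ l) * Uᵀ := by
  have hH : X.IsHermitian := by
    rw [IsHermitian, conjTranspose_eq_transpose_of_trivial]; exact hX
  set U : Matrix n n ℝ := hH.eigenvectorUnitary.1 with hU
  have h1 : Uᵀ * U = 1 := by
    have := Unitary.coe_star_mul_self hH.eigenvectorUnitary
    rwa [star_eq_conjTranspose, conjTranspose_eq_transpose_of_trivial] at this
  have h2 : U * Uᵀ = 1 := by
    have := Unitary.mul_star_self_of_mem hH.eigenvectorUnitary.2
    rwa [star_eq_conjTranspose, conjTranspose_eq_transpose_of_trivial] at this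
  refine ⟨U, hH.eigenvalues, h1, h2, fun l => ?_⟩
  have h3 : X = U * diagonal hH.eigenvalues * Uᵀ := by
    have := hH.spectral_theorem
    rw [Unitary.conjStarAlgAut_apply, star_eq_conjTranspose,
      conjTranspose_eq_transpose_of_trivial] at this
    exact this
  induction l with
  | zero => simp [h2]
  | succ l ih =>
    have e : diagonal (fun i => hH.eigenvalues i ^ (l + 1)) =
        diagonal (fun i => hH.eigenvalues i ^ l) * diagonal hH.eigenvalues := by
      rw [diagonal_mul_diagonal]; simp [pow_succ]
    rw [pow_succ, ih, e]
    nth_rewrite 2 [h3]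
    calc U * diagonal (fun i => hH.eigenvalues i ^ l) * Uᵀ * (U * diagonal hH.eigenvalues * Uᵀ)
        = U * diagonal (fun i => hH.eigenvalues i ^ l) * (Uᵀ * U) *
          (diagonal hH.eigenvalues * Uᵀ) := by simp only [Matrix.mul_assoc]
      _ = _ := by rw [h1]; simp only [Matrix.mul_assoc, Matrix.mul_one]

/-- In an eigenbasis of X the matrix A becomes a symmetric B, and the weights are B_pq². They do not
depend on the exponents, so traces with different l and m can be compared term by term. -/
lemma exists_trace_mul_pow_mul_pow {X : Matrix n n ℝ} (hX : X.IsSymm) {A : Matrix n n ℝ}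
    (hA : A.IsSymm) :
    ∃ (d : n → ℝ) (w : n → n → ℝ), (∀ p q, 0 ≤ w p q) ∧ ∀ l m : ℕ,
      trace (A * X ^ l * A * X ^ m) = ∑ p, ∑ q, w p q * (d p ^ l * d q ^ m) := by
  obtain ⟨U, d, h1, h2, hp⟩ := exists_orthogonal_diagonalization hX
  set B := Uᵀ * A * U with hB
  have hBs : Bᵀ = B := by
    rw [hB, transpose_mul, transpose_mul, transpose_transpose, hA, Matrix.mul_assoc]
  refine ⟨d, fun p q => B p q ^ 2, fun p q => sq_nonneg _, fun l m => ?_⟩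
  have e : trace (A * X ^ l * A * X ^ m) =
      trace (B * diagonal (fun i => d i ^ l) * (B * diagonal (fun i => d i ^ m))) := by
    rw [hp l, hp m]
    rw [show A * (U * diagonal (fun i => d i ^ l) * Uᵀ) * A *
        (U * diagonal (fun i => d i ^ m) * Uᵀ) = (A * U * diagonal (fun i => d i ^ l) * Uᵀ * A *
        U * diagonal (fun i => d i ^ m)) * Uᵀ by simp only [Matrix.mul_assoc], trace_mul_comm]
    simp only [hB, Matrix.mul_assoc]
  rw [e]
  simp only [trace, diag_apply, mul_apply (M := B * _), mul_diagonal]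
  rw [Finset.sum_comm]
  refine Finset.sum_congr rfl fun p _ => Finset.sum_congr rfl fun q _ => ?_
  have : B q p = B p q := congrFun (congrFun hBs p) q
  rw [this]; ring

/-- Termwise, |d_p|^l |d_q|^m is at most the larger of |d_p|^(l+m) and |d_q|^(l+m), hence at most
their sum. Evenness of l + m removes the absolute values. -/
lemma trace_mul_pow_mul_pow_le {X A : Matrix n n ℝ} (hX : X.IsSymm) (hA : A.IsSymm)
    {l m : ℕ} (hlm : Even (l + m)) :
    trace (A * X ^ l * A * X ^ m) ≤ 2 * trace (A * A * X ^ (l + m)) := by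
  obtain ⟨d, w, hw, h⟩ := exists_trace_mul_pow_mul_pow hX hA
  have h0 := h 0 (l + m)
  have h0' := h (l + m) 0
  have e : trace (A * X ^ (l + m) * A) = trace (A * A * X ^ (l + m)) := by
    rw [trace_mul_comm, Matrix.mul_assoc]
  simp only [pow_zero, one_mul, mul_one] at h0 h0'
  rw [e] at h0'
  have : 2 * trace (A * A * X ^ (l + m)) =
      ∑ p, ∑ q, w p q * (d p ^ (l + m) + d q ^ (l + m)) := by
    simp only [mul_add, Finset.sum_add_distrib]
    linarith
  rw [this, h]
  refine Finset.sum_le_sum fun p _ => Finset.sum_le_sum fun q _ => ?_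
  refine mul_le_mul_of_nonneg_left ?_ (hw p q)
  rw [← hlm.pow_abs (d p), ← hlm.pow_abs (d q)]
  refine (le_abs_self _).trans ?_
  rw [abs_mul, abs_pow, abs_pow]
  rcases le_total |d p| |d q| with hpq | hpq
  · calc |d p| ^ l * |d q| ^ m ≤ |d q| ^ l * |d q| ^ m := by gcongr
      _ = |d q| ^ (l + m) := (pow_add _ _ _).symm
      _ ≤ _ := le_add_of_nonneg_left (by positivity)
  · calc |d p| ^ l * |d q| ^ m ≤ |d p| ^ l * |d p| ^ m := by gcongr
      _ = |d p| ^ (l + m) := (pow_add _ _ _).symm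
      _ ≤ _ := le_add_of_nonneg_right (by positivity)

/-- A Young inequality obtained by comparing 2a with b. The coefficient 1/2 of b^(M+1) is what later
permits absorption into the left-hand side. -/
lemma mul_pow_le_half_pow_add {a b : ℝ} (ha : 0 ≤ a) (hb : 0 ≤ b) (M : ℕ) :
    a * b ^ M ≤ b ^ (M + 1) / 2 + (2 * a) ^ (M + 1) / 2 := by
  rcases le_total (2 * a) b with h | h
  · have : 2 * a * b ^ M ≤ b * b ^ M := by gcongr
    have h2 : 0 ≤ (2 * a) ^ (M + 1) := by positivity
    rw [pow_succ' b]; linarith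
  · have : 2 * a * b ^ M ≤ 2 * a * (2 * a) ^ M := by gcongr
    have h2 : 0 ≤ b ^ (M + 1) := by positivity
    rw [pow_succ' (2 * a)]; linarith

lemma eigenvalue_nonneg_of_posSemidef {S U : Matrix n n ℝ} {s : n → ℝ} (hS : S.PosSemidef)
    (h1 : Uᵀ * U = 1) (h : S = U * diagonal s * Uᵀ) (p : n) : 0 ≤ s p := by
  have h3 : Uᵀ * S * U = diagonal s := by
    rw [h]
    calc Uᵀ * (U * diagonal s * Uᵀ) * U = (Uᵀ * U) * diagonal s * (Uᵀ * U) := by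
          simp only [Matrix.mul_assoc]
      _ = _ := by rw [h1]; simp
  have h4 : (diagonal s).PosSemidef := by
    rw [← h3]
    have := hS.conjTranspose_mul_mul_same U
    rwa [conjTranspose_eq_transpose_of_trivial] at this
  exact posSemidef_diagonal_iff.1 h4 p

omit [Fintype n] [DecidableEq n] in
lemma posSemidef_isSymm {S : Matrix n n ℝ} (hS : S.PosSemidef) : S.IsSymm := by
  have := hS.isHermitian
  rwa [IsHermitian, conjTranspose_eq_transpose_of_trivial] at this

/-- In eigenbases of S and X all three traces are sums with the same weights, the squared inner
products of eigenvectors, so the scalar inequality with a = c s_p and b = d_q² can be summed. -/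
lemma trace_mul_pow_le {S X : Matrix n n ℝ} (hS : S.PosSemidef) (hX : X.IsSymm) (M : ℕ)
    {c : ℝ} (hc : 0 ≤ c) :
    c * trace (S * X ^ (2 * M)) ≤
      trace (X ^ (2 * (M + 1))) / 2 + (2 * c) ^ (M + 1) / 2 * trace (S ^ (M + 1)) := by
  obtain ⟨U, d, hU1, hU2, hUp⟩ := exists_orthogonal_diagonalization hX
  obtain ⟨V, s, hV1, hV2, hVp⟩ := exists_orthogonal_diagonalization (posSemidef_isSymm hS)
  have hs : ∀ p, 0 ≤ s p := eigenvalue_nonneg_of_posSemidef hS hV1 (by simpa using hVp 1)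
  set w := Vᵀ * U with hw
  have key : ∀ a b : ℕ, trace (S ^ a * X ^ b) = ∑ p, ∑ q, w p q ^ 2 * (s p ^ a * d q ^ b) := by
    intro a b
    have e : trace (S ^ a * X ^ b) =
        trace ((diagonal (fun i => s i ^ a) * w) * (diagonal (fun i => d i ^ b) * wᵀ)) := by
      rw [hVp, hUp, show V * diagonal (fun i => s i ^ a) * Vᵀ *
        (U * diagonal (fun i => d i ^ b) * Uᵀ) = V * (diagonal (fun i => s i ^ a) * Vᵀ *
        (U * diagonal (fun i => d i ^ b) * Uᵀ)) by simp only [Matrix.mul_assoc], trace_mul_comm,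
        hw, transpose_mul, transpose_transpose]
      simp only [Matrix.mul_assoc]
    rw [e]
    simp only [trace, diag_apply, mul_apply (M := diagonal _ * w), diagonal_mul, transpose_apply]
    refine Finset.sum_congr rfl fun p _ => Finset.sum_congr rfl fun q _ => ?_
    ring
  have k1 := key 1 (2 * M)
  have k2 := key 0 (2 * (M + 1))
  have k3 := key (M + 1) 0
  simp only [pow_one, pow_zero, one_mul, mul_one] at k1 k2 k3
  rw [k1, k2, k3, Finset.mul_sum, Finset.sum_div, Finset.mul_sum, ← Finset.sum_add_distrib]
  refine Finset.sum_le_sum fun p _ => ?_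
  rw [Finset.mul_sum, Finset.sum_div, Finset.mul_sum, ← Finset.sum_add_distrib]
  refine Finset.sum_le_sum fun q _ => ?_
  have h := mul_pow_le_half_pow_add (mul_nonneg hc (hs p)) (sq_nonneg (d q)) M
  rw [← pow_mul, ← pow_mul, ← mul_assoc 2 c, mul_pow] at h
  have := mul_le_mul_of_nonneg_left h (sq_nonneg (w p q))
  nlinarith [this]

/-- The witness is the largest eigenvalue of S; its M-th power is one term of the trace. -/
lemma exists_le_trace_pow {S : Matrix n n ℝ} (hS : S.PosSemidef) {M : ℕ} (hM : 1 ≤ M) :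
    ∃ c : ℝ, 0 ≤ c ∧ c ^ M ≤ trace (S ^ M) ∧
      ∀ x : n → ℝ, (S *ᵥ x) ⬝ᵥ (S *ᵥ x) ≤ c * (x ⬝ᵥ (S *ᵥ x)) := by
  obtain ⟨V, s, hV1, hV2, hVp⟩ := exists_orthogonal_diagonalization (posSemidef_isSymm hS)
  have hs : ∀ p, 0 ≤ s p := eigenvalue_nonneg_of_posSemidef hS hV1 (by simpa using hVp 1)
  have htr : trace (S ^ M) = ∑ p, s p ^ M := by
    rw [hVp, Matrix.mul_assoc, trace_mul_comm, Matrix.mul_assoc, hV1]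
    simp [trace]
  have hdot : ∀ l, ∀ x : n → ℝ, x ⬝ᵥ (S ^ l *ᵥ x) = ∑ p, s p ^ l * (Vᵀ *ᵥ x) p ^ 2 := by
    intro l x
    rw [hVp, Matrix.mul_assoc, ← mulVec_mulVec, dotProduct_mulVec, ← mulVec_transpose,
      ← mulVec_mulVec]
    simp only [dotProduct, mulVec_diagonal]
    refine Finset.sum_congr rfl fun p _ => ?_
    ring
  have hdot2 : ∀ x : n → ℝ, (S *ᵥ x) ⬝ᵥ (S *ᵥ x) = x ⬝ᵥ (S ^ 2 *ᵥ x) := by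
    intro x
    rw [pow_two, ← mulVec_mulVec, dotProduct_mulVec x, ← mulVec_transpose,
      posSemidef_isSymm hS]
  rcases isEmpty_or_nonempty n with hn | hn
  · refine ⟨0, le_rfl, ?_, fun x => ?_⟩
    · rw [htr, zero_pow (by omega)]; simp
    · simp [dotProduct]
  · obtain ⟨p, hp⟩ := Finite.exists_max s
    refine ⟨s p, hs p, ?_, fun x => ?_⟩
    · rw [htr]
      exact Finset.single_le_sum (f := fun p => s p ^ M) (fun q _ => pow_nonneg (hs q) M)
        (Finset.mem_univ p)
    · have := hdot 1 x
      rw [pow_one] at this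
      rw [hdot2, hdot, this, Finset.mul_sum]
      refine Finset.sum_le_sum fun q _ => ?_
      rw [← mul_assoc, pow_two (s q), pow_one]
      exact mul_le_mul_of_nonneg_right (mul_le_mul_of_nonneg_right (hp q) (hs q)) (sq_nonneg _)

/-- All eigenvalues are at most ρ. Keeping one factor as a trace is what avoids a factor equal to
the dimension. -/
lemma trace_pow_le_of_dotProduct_le {S : Matrix n n ℝ} (hS : S.PosSemidef) {ρ : ℝ}
    (hρ : ∀ x : n → ℝ, x ⬝ᵥ (S *ᵥ x) ≤ ρ * (x ⬝ᵥ x)) (M : ℕ) :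
    trace (S ^ (M + 1)) ≤ ρ ^ M * trace S := by
  obtain ⟨V, s, hV1, hV2, hVp⟩ := exists_orthogonal_diagonalization (posSemidef_isSymm hS)
  have hs : ∀ p, 0 ≤ s p := eigenvalue_nonneg_of_posSemidef hS hV1 (by simpa using hVp 1)
  have htr : ∀ l, trace (S ^ l) = ∑ p, s p ^ l := by
    intro l
    rw [hVp, Matrix.mul_assoc, trace_mul_comm, Matrix.mul_assoc, hV1]
    simp [trace]
  have hsρ : ∀ p, s p ≤ ρ := by
    intro p
    have h := hρ (V *ᵥ Pi.single p 1)
    have hS1 : S = V * diagonal s * Vᵀ := by simpa using hVp 1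
    have e : ∀ y : n → ℝ, (V *ᵥ Pi.single p 1) ⬝ᵥ (V *ᵥ y) = y p := by
      intro y
      rw [dotProduct_mulVec, ← mulVec_transpose, mulVec_mulVec, hV1, one_mulVec, single_dotProduct,
        one_mul]
    rw [e, hS1, mulVec_mulVec, Matrix.mul_assoc, Matrix.mul_assoc, hV1, Matrix.mul_one,
      ← mulVec_mulVec, e] at h
    simpa [mulVec_diagonal] using h
  rw [htr, ← pow_one S, htr, Finset.mul_sum]
  refine Finset.sum_le_sum fun p _ => ?_
  rw [pow_succ, pow_one]
  exact mul_le_mul_of_nonneg_right (pow_le_pow_left₀ (hs p) (hsρ p) M) (hs p)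

end

/-! ### Noncommutative Khintchine inequality -/

section

open Matrix

section Trace

variable {J : Type*} [Fintype J] {n : Type*} [Fintype n] [DecidableEq n]

omit [DecidableEq n] [Fintype J] in
lemma map_pderiv_mul (i : J) (P Q : Matrix n n (MvPolynomial J ℝ)) :
    (P * Q).map (MvPolynomial.pderiv i) =
      P.map (MvPolynomial.pderiv i) * Q + P * Q.map (MvPolynomial.pderiv i) := by
  ext1 a b
  simp only [map_apply, mul_apply, Matrix.add_apply]
  rw [map_sum, ← Finset.sum_add_distrib]
  refine Finset.sum_congr rfl fun c _ => ?_
  rw [Derivation.leibniz, smul_eq_mul, smul_eq_mul]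
  ring

omit [Fintype J] in
lemma map_pderiv_pow (i : J) {P D : Matrix n n (MvPolynomial J ℝ)}
    (hD : P.map (MvPolynomial.pderiv i) = D) (l : ℕ) :
    (P ^ l).map (MvPolynomial.pderiv i) = ∑ j ∈ Finset.range l, P ^ j * D * P ^ (l - 1 - j) := by
  induction l with
  | zero =>
    ext1 a b
    by_cases h : a = b <;> simp [h]
  | succ l ih =>
    rw [pow_succ, map_pderiv_mul, ih, hD, Finset.sum_range_succ, Finset.sum_mul,
      Nat.add_sub_cancel, Nat.sub_self, pow_zero, mul_one]
    refine congrArg (· + P ^ l * D) (Finset.sum_congr rfl fun j hj => ?_)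
    have := Finset.mem_range.1 hj
    rw [mul_assoc, ← pow_succ, show l - 1 - j + 1 = l - j by omega]

/-- The matrix `∑ i, X i • A i` of linear forms. -/
def linMat (A : J → Matrix n n ℝ) : Matrix n n (MvPolynomial J ℝ) :=
  ∑ i, (MvPolynomial.X i : MvPolynomial J ℝ) • (A i).map MvPolynomial.C

omit [Fintype n] [DecidableEq n] in
lemma linMat_map_pderiv (A : J → Matrix n n ℝ) (i : J) :
    (linMat A).map (MvPolynomial.pderiv i) = (A i).map MvPolynomial.C := by
  classical
  ext a b
  simp only [linMat, map_apply, Matrix.sum_apply, Matrix.smul_apply, smul_eq_mul, map_sum,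
    Derivation.leibniz, MvPolynomial.pderiv_C, MvPolynomial.pderiv_X, mul_zero, zero_add]
  simp [Pi.single_apply]

lemma mapMatrix_eval_linMat (A : J → Matrix n n ℝ) (x : J → ℝ) :
    (MvPolynomial.eval x).mapMatrix (linMat A) = ∑ i, x i • A i := by
  ext a b
  simp [linMat, Matrix.sum_apply]

omit [Fintype J] in
lemma mapMatrix_eval_C (A : Matrix n n ℝ) (x : J → ℝ) :
    (MvPolynomial.eval x).mapMatrix (A.map MvPolynomial.C) = A := by
  ext a b
  simp

omit [Fintype J] in
lemma eval_trace (P : Matrix n n (MvPolynomial J ℝ)) (x : J → ℝ) :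
    MvPolynomial.eval x P.trace = ((MvPolynomial.eval x).mapMatrix P).trace := by
  simp [trace, map_sum]

lemma integrable_trace_stdGauss {F : (J → ℝ) → Matrix n n ℝ}
    (P : Matrix n n (MvPolynomial J ℝ)) (h : ∀ x, (MvPolynomial.eval x).mapMatrix P = F x) :
    Integrable (fun x => (F x).trace) (stdGauss J) := by
  simp_rw [← h, ← eval_trace]
  exact integrable_eval_stdGauss _

lemma integrable_trace_mul_pow (A : J → Matrix n n ℝ) (B : Matrix n n ℝ) (l : ℕ) :
    Integrable (fun x => (B * (∑ i, x i • A i) ^ l).trace) (stdGauss J) :=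
  integrable_trace_stdGauss (B.map MvPolynomial.C * linMat A ^ l) fun x => by
    rw [map_mul, map_pow, mapMatrix_eval_linMat, mapMatrix_eval_C]

lemma integrable_trace_mul_pow_mul_pow (A : J → Matrix n n ℝ) (B : Matrix n n ℝ) (l m : ℕ) :
    Integrable (fun x => (B * (∑ i, x i • A i) ^ l * B * (∑ i, x i • A i) ^ m).trace)
      (stdGauss J) :=
  integrable_trace_stdGauss
    (B.map MvPolynomial.C * linMat A ^ l * B.map MvPolynomial.C * linMat A ^ m) fun x => by
      rw [map_mul, map_mul, map_mul, map_pow, map_pow, mapMatrix_eval_linMat, mapMatrix_eval_C]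

/-- Integration by parts in x_i followed by the noncommutative Leibniz rule: k is the position of
the differentiated factor. -/
lemma integral_mul_trace_mul_pow (A : J → Matrix n n ℝ) (i : J) (l : ℕ) :
    ∫ x, x i * (A i * (∑ j, x j • A j) ^ l).trace ∂stdGauss J =
      ∑ k ∈ Finset.range l, ∫ x, (A i * (∑ j, x j • A j) ^ k * A i *
        (∑ j, x j • A j) ^ (l - 1 - k)).trace ∂stdGauss J := by
  have e1 : ∀ x : J → ℝ, (A i * (∑ j, x j • A j) ^ l).trace =
      MvPolynomial.eval x ((A i).map MvPolynomial.C * linMat A ^ l).trace := by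
    intro x
    rw [eval_trace, map_mul, map_pow, mapMatrix_eval_linMat, mapMatrix_eval_C]
  simp_rw [e1]
  rw [integral_X_mul_eval_stdGauss, ← integral_finsetSum _
    (fun k _ => integrable_trace_mul_pow_mul_pow A (A i) k (l - 1 - k))]
  refine integral_congr_ae (Filter.Eventually.of_forall fun x => ?_)
  simp only
  have e2 : MvPolynomial.pderiv i ((A i).map MvPolynomial.C * linMat A ^ l).trace =
      ∑ k ∈ Finset.range l, ((A i).map MvPolynomial.C * linMat A ^ k *
        (A i).map MvPolynomial.C * linMat A ^ (l - 1 - k)).trace := by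
    have : ∀ Q : Matrix n n (MvPolynomial J ℝ),
        MvPolynomial.pderiv i Q.trace = (Q.map (MvPolynomial.pderiv i)).trace := fun Q => by
      simp [trace, map_sum]
    rw [this, map_pderiv_mul, map_pderiv_pow i (linMat_map_pderiv A i)]
    have h0 : ((A i).map (MvPolynomial.C (σ := J))).map (MvPolynomial.pderiv i) = 0 := by
      ext a b; simp
    rw [h0, Matrix.zero_mul, zero_add, Finset.mul_sum, trace_sum]
    simp only [Matrix.mul_assoc]
  rw [e2, map_sum]
  refine Finset.sum_congr rfl fun k _ => ?_
  rw [eval_trace, map_mul, map_mul, map_mul, map_pow, map_pow, mapMatrix_eval_linMat,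
    mapMatrix_eval_C]

omit [Fintype n] [DecidableEq n] in
lemma isSymm_sum_smul {A : J → Matrix n n ℝ} (hA : ∀ i, (A i).IsSymm) (x : J → ℝ) :
    (∑ i, x i • A i).IsSymm := by
  rw [IsSymm, transpose_sum]
  exact Finset.sum_congr rfl fun i _ => by rw [transpose_smul, hA i]

omit [DecidableEq n] in
lemma posSemidef_sum_mul_self {A : J → Matrix n n ℝ} (hA : ∀ i, (A i).IsSymm) :
    (∑ i, A i * A i).PosSemidef := by
  refine posSemidef_sum _ fun i _ => ?_
  have := posSemidef_conjTranspose_mul_self (A i)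
  rwa [conjTranspose_eq_transpose_of_trivial, hA i] at this

/-- A Khintchine inequality for even traces of symmetric Gaussian matrices. -/
theorem integral_trace_pow_le {A : J → Matrix n n ℝ} (hA : ∀ i, (A i).IsSymm) {M : ℕ}
    (hM : 1 ≤ M) :
    ∫ x, ((∑ i, x i • A i) ^ (2 * M)).trace ∂stdGauss J ≤
      (8 * M : ℝ) ^ M * ((∑ i, A i * A i) ^ M).trace := by
  obtain ⟨N, rfl⟩ : ∃ N, M = N + 1 := ⟨M - 1, by omega⟩
  set S := ∑ i, A i * A i with hS
  have hSpos : S.PosSemidef := posSemidef_sum_mul_self hA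
  have hint : Integrable (fun x : J → ℝ => ((∑ i, x i • A i) ^ (2 * (N + 1))).trace)
      (stdGauss J) := by
    simpa using integrable_trace_mul_pow A 1 (2 * (N + 1))
  have hint2 : Integrable (fun x : J → ℝ => (S * (∑ i, x i • A i) ^ (2 * N)).trace)
      (stdGauss J) := integrable_trace_mul_pow A S (2 * N)
  have h1 : ∫ x, ((∑ i, x i • A i) ^ (2 * (N + 1))).trace ∂stdGauss J =
      ∑ i, ∑ k ∈ Finset.range (2 * N + 1), ∫ x, (A i * (∑ j, x j • A j) ^ k * A i *
        (∑ j, x j • A j) ^ (2 * N + 1 - 1 - k)).trace ∂stdGauss J := by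
    simp_rw [← integral_mul_trace_mul_pow]
    rw [← integral_finsetSum]
    · refine integral_congr_ae (Filter.Eventually.of_forall fun x => ?_)
      simp only
      rw [show 2 * (N + 1) = (2 * N + 1) + 1 by ring, pow_succ', Finset.sum_mul, trace_sum]
      exact Finset.sum_congr rfl fun i _ => by rw [Matrix.smul_mul, trace_smul, smul_eq_mul]
    · intro i _
      refine (integrable_eval_stdGauss (MvPolynomial.X i *
        ((A i).map MvPolynomial.C * linMat A ^ (2 * N + 1)).trace)).congr
        (Filter.Eventually.of_forall fun x => ?_)
      simp only [map_mul, MvPolynomial.eval_X, eval_trace, map_pow, mapMatrix_eval_linMat,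
        mapMatrix_eval_C]
  have h2 : ∀ i, ∀ k ∈ Finset.range (2 * N + 1), ∫ x, (A i * (∑ j, x j • A j) ^ k * A i *
        (∑ j, x j • A j) ^ (2 * N + 1 - 1 - k)).trace ∂stdGauss J ≤
        ∫ x, 2 * (A i * A i * (∑ j, x j • A j) ^ (2 * N)).trace ∂stdGauss J := by
    intro i k hk
    have hk' := Finset.mem_range.1 hk
    refine integral_mono (integrable_trace_mul_pow_mul_pow A (A i) k _)
      ((integrable_trace_mul_pow A (A i * A i) (2 * N)).const_mul 2) fun x => ?_
    have e : k + (2 * N + 1 - 1 - k) = 2 * N := by omega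
    have := trace_mul_pow_mul_pow_le (isSymm_sum_smul hA x) (hA i) (l := k)
      (m := 2 * N + 1 - 1 - k) (by rw [e]; exact even_two_mul N)
    rwa [e] at this
  -- Each of the 2N + 1 positions contributes at most twice the term with the two copies of A_i
  -- adjacent.
  have h3 : ∫ x, ((∑ i, x i • A i) ^ (2 * (N + 1))).trace ∂stdGauss J ≤
      ∫ x, (2 * (2 * N + 1) : ℝ) * (S * (∑ i, x i • A i) ^ (2 * N)).trace ∂stdGauss J := by
    rw [h1]
    refine (Finset.sum_le_sum fun i _ => Finset.sum_le_sum (h2 i)).trans (le_of_eq ?_)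
    simp only [Finset.sum_const, Finset.card_range, nsmul_eq_mul, ← Finset.mul_sum]
    simp_rw [integral_const_mul]
    rw [← Finset.mul_sum, ← integral_finsetSum _
      (fun i _ => integrable_trace_mul_pow A (A i * A i) (2 * N))]
    simp_rw [← trace_sum, ← Finset.sum_mul, ← hS]
    push_cast
    ring
  -- Half of the original moment reappears on the right; being finite, it is subtracted at the end.
  -- The constant 8M comes from 4(2N + 1) ≤ 8(N + 1).
  have h4 : ∫ x, (2 * (2 * N + 1) : ℝ) * (S * (∑ i, x i • A i) ^ (2 * N)).trace ∂stdGauss J ≤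
      ∫ x, (((∑ i, x i • A i) ^ (2 * (N + 1))).trace / 2 +
        (2 * (2 * (2 * N + 1)) : ℝ) ^ (N + 1) / 2 * (S ^ (N + 1)).trace) ∂stdGauss J :=
    integral_mono (hint2.const_mul _) ((hint.div_const 2).add (integrable_const _)) fun x =>
      trace_mul_pow_le hSpos (isSymm_sum_smul hA x) N (by positivity)
  rw [integral_add (hint.div_const 2) (integrable_const _), integral_div, integral_const] at h4
  simp only [probReal_univ, one_smul] at h4
  have h5 : 0 ≤ (S ^ (N + 1)).trace := (hSpos.pow _).trace_nonneg
  have h6 : (2 * (2 * (2 * N + 1)) : ℝ) ^ (N + 1) ≤ (8 * ((N + 1 : ℕ) : ℝ)) ^ (N + 1) := by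
    refine pow_le_pow_left₀ (by positivity) ?_ _
    push_cast; linarith
  have h7 := mul_le_mul_of_nonneg_right h6 h5
  linarith

end Trace

/-! ### Rectangular matrices through the symmetric dilation -/

section Rectangular

variable {J L R : Type*} [Fintype J] [Fintype L] [Fintype R] [DecidableEq L] [DecidableEq R]

omit [DecidableEq L] [DecidableEq R] in
lemma trace_fromBlocks_zero (B : Matrix L L ℝ) (C : Matrix R R ℝ) :
    (fromBlocks B 0 0 C).trace = B.trace + C.trace := by
  simp [trace]

lemma fromBlocks_zero_pow (B : Matrix L R ℝ) (M : ℕ) :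
    (fromBlocks 0 B Bᵀ 0) ^ (2 * M) = fromBlocks ((B * Bᵀ) ^ M) 0 0 ((Bᵀ * B) ^ M) := by
  rw [pow_mul, pow_two, fromBlocks_multiply]
  simp only [Matrix.zero_mul, Matrix.mul_zero, zero_add, add_zero]
  exact fromBlocks_diagonal_pow _ _ _

omit [DecidableEq L] in
lemma trace_transpose_mul_pow_nonneg (B : Matrix L R ℝ) (M : ℕ) :
    0 ≤ ((Bᵀ * B) ^ M).trace := by
  have := (posSemidef_conjTranspose_mul_self B).pow M
  rw [conjTranspose_eq_transpose_of_trivial] at this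
  exact this.trace_nonneg

/-- Khintchine applied to the dilations [0 B; Bᵀ 0], whose even powers are block diagonal. On the
left the nonnegative second block is dropped; on the right both blocks remain. -/
theorem lintegral_trace_mul_transpose_pow_le (B : J → Matrix L R ℝ) {M : ℕ} (hM : 1 ≤ M) :
    ∫⁻ x, ENNReal.ofReal (((∑ i, x i • B i) * (∑ i, x i • B i)ᵀ) ^ M).trace ∂stdGauss J ≤
      ENNReal.ofReal ((8 * M : ℝ) ^ M *
        (((∑ i, B i * (B i)ᵀ) ^ M).trace + ((∑ i, (B i)ᵀ * B i) ^ M).trace)) := by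
  set A : J → Matrix (L ⊕ R) (L ⊕ R) ℝ := fun i => fromBlocks 0 (B i) (B i)ᵀ 0 with hA
  have hAs : ∀ i, (A i).IsSymm := fun i => by
    simp [hA, IsSymm, fromBlocks_transpose]
  have hX : ∀ x : J → ℝ, ∑ i, x i • A i =
      fromBlocks 0 (∑ i, x i • B i) (∑ i, x i • B i)ᵀ 0 := by
    intro x
    ext (a | a) (b | b) <;> simp [hA, Matrix.sum_apply]
  have hS : ∑ i, A i * A i = fromBlocks (∑ i, B i * (B i)ᵀ) 0 0 (∑ i, (B i)ᵀ * B i) := by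
    simp only [hA, fromBlocks_multiply]
    ext (a | a) (b | b) <;> simp [Matrix.sum_apply]
  have h := integral_trace_pow_le hAs hM
  rw [hS, fromBlocks_diagonal_pow, trace_fromBlocks_zero] at h
  refine le_trans ?_ (ENNReal.ofReal_le_ofReal h)
  have hle : ∀ x : J → ℝ, (((∑ i, x i • B i) * (∑ i, x i • B i)ᵀ) ^ M).trace ≤
      ((∑ i, x i • A i) ^ (2 * M)).trace := fun x => by
    rw [hX, fromBlocks_zero_pow, trace_fromBlocks_zero]
    exact le_add_of_nonneg_right (trace_transpose_mul_pow_nonneg _ M)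
  rw [ofReal_integral_eq_lintegral_ofReal]
  · exact lintegral_mono fun x => ENNReal.ofReal_le_ofReal (hle x)
  · simpa using integrable_trace_mul_pow A 1 (2 * M)
  · refine Filter.Eventually.of_forall fun x => le_trans ?_ (hle x)
    have := trace_transpose_mul_pow_nonneg (∑ i, x i • B i)ᵀ M
    rwa [transpose_transpose] at this

end Rectangular

/-! ### Moments of Gaussian quadratic forms -/

section Quadratic

variable {J : Type*} [Fintype J] [DecidableEq J]

/-- With q = x·Sx, integrating x_a against (Sx)_a q^M by parts gives tr S · q^M + 2M q^(M-1) |Sx|²,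
and |Sx|² ≤ c q. -/
lemma integral_quadratic_pow_succ_le {S : Matrix J J ℝ} (hS : S.PosSemidef) {c : ℝ}
    (hc : ∀ x : J → ℝ, (S *ᵥ x) ⬝ᵥ (S *ᵥ x) ≤ c * (x ⬝ᵥ (S *ᵥ x))) (M : ℕ) :
    ∫ x, (x ⬝ᵥ (S *ᵥ x)) ^ (M + 1) ∂stdGauss J ≤
      (S.trace + 2 * M * c) * ∫ x, (x ⬝ᵥ (S *ᵥ x)) ^ M ∂stdGauss J := by
  set l : J → MvPolynomial J ℝ := fun a => ∑ b, MvPolynomial.C (S a b) * MvPolynomial.X b with hl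
  set q : MvPolynomial J ℝ := ∑ a, MvPolynomial.X a * l a with hq
  have hle : ∀ x a, MvPolynomial.eval x (l a) = (S *ᵥ x) a := fun x a => by
    simp [hl, mulVec, dotProduct, map_sum]
  have hqe : ∀ x, MvPolynomial.eval x q = x ⬝ᵥ (S *ᵥ x) := fun x => by
    simp [hq, dotProduct, map_sum, hle]
  have hsym : ∀ a b, S a b = S b a := fun a b => congrFun (congrFun (posSemidef_isSymm hS) b) a
  have hdl : ∀ a b, MvPolynomial.pderiv a (l b) = MvPolynomial.C (S b a) := fun a b => by
    simp [hl, map_sum, Derivation.leibniz, MvPolynomial.pderiv_X, Pi.single_apply]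
  have hdq : ∀ a, MvPolynomial.pderiv a q = 2 * l a := fun a => by
    simp only [hq, map_sum, Derivation.leibniz, hdl, MvPolynomial.pderiv_X, smul_eq_mul,
      Finset.sum_add_distrib]
    have : l a = ∑ b, MvPolynomial.X b * MvPolynomial.C (S b a) :=
      Finset.sum_congr rfl fun b _ => by rw [hsym a b, mul_comm]
    rw [← this]
    simp [Pi.single_apply]
    ring
  have hnn : ∀ x : J → ℝ, 0 ≤ x ⬝ᵥ (S *ᵥ x) := fun x => by
    simpa using hS.dotProduct_mulVec_nonneg x
  have hint : ∀ m : ℕ, Integrable (fun x : J → ℝ => (x ⬝ᵥ (S *ᵥ x)) ^ m) (stdGauss J) := by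
    intro m
    simp_rw [← hqe, ← map_pow]
    exact integrable_eval_stdGauss _
  have h1 : ∫ x, (x ⬝ᵥ (S *ᵥ x)) ^ (M + 1) ∂stdGauss J =
      ∑ a, ∫ x, MvPolynomial.eval x (MvPolynomial.pderiv a (l a * q ^ M)) ∂stdGauss J := by
    simp_rw [← integral_X_mul_eval_stdGauss]
    rw [← integral_finsetSum]
    · refine integral_congr_ae (Filter.Eventually.of_forall fun x => ?_)
      simp only
      rw [pow_succ', ← hqe x]
      nth_rewrite 1 [hq]
      simp only [map_sum, Finset.sum_mul, map_mul, map_pow, MvPolynomial.eval_X]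
      exact Finset.sum_congr rfl fun a _ => by ring
    · intro a _
      have := integrable_eval_stdGauss (MvPolynomial.X a * (l a * q ^ M))
      simpa only [map_mul, MvPolynomial.eval_X] using this
  rw [h1, ← integral_finsetSum _ (fun a _ => integrable_eval_stdGauss _), ← integral_const_mul]
  refine integral_mono (integrable_finsetSum _ fun a _ => integrable_eval_stdGauss _)
    ((hint M).const_mul _) fun x => ?_
  simp only
  have h2 : ∑ a, MvPolynomial.eval x (MvPolynomial.pderiv a (l a * q ^ M)) =
      S.trace * (x ⬝ᵥ (S *ᵥ x)) ^ M +
        2 * M * (x ⬝ᵥ (S *ᵥ x)) ^ (M - 1) * ((S *ᵥ x) ⬝ᵥ (S *ᵥ x)) := by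
    simp only [Derivation.leibniz, Derivation.leibniz_pow, hdl, hdq, smul_eq_mul, map_add,
      map_mul, map_pow, hqe, hle, nsmul_eq_mul, MvPolynomial.eval_C, map_ofNat,
      Finset.sum_add_distrib, map_natCast]
    rw [add_comm, trace, Finset.sum_mul]
    congr 1
    · exact Finset.sum_congr rfl fun a _ => by rw [diag_apply]; ring
    · rw [show (S *ᵥ x) ⬝ᵥ (S *ᵥ x) = ∑ a, (S *ᵥ x) a * (S *ᵥ x) a from rfl, Finset.mul_sum]
      exact Finset.sum_congr rfl fun a _ => by ring
  rw [h2, add_mul]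
  refine add_le_add le_rfl ?_
  rcases M with _ | M
  · simp
  · have h3 := mul_le_mul_of_nonneg_left (hc x) (pow_nonneg (hnn x) M)
    rw [Nat.add_sub_cancel]
    calc _ = 2 * ((M + 1 : ℕ) : ℝ) * ((x ⬝ᵥ (S *ᵥ x)) ^ M * ((S *ᵥ x) ⬝ᵥ (S *ᵥ x))) := by ring
      _ ≤ 2 * ((M + 1 : ℕ) : ℝ) * ((x ⬝ᵥ (S *ᵥ x)) ^ M * (c * (x ⬝ᵥ (S *ᵥ x)))) := by gcongr
      _ = _ := by ring

lemma integral_quadratic_pow_le {S : Matrix J J ℝ} (hS : S.PosSemidef) {c : ℝ} (hc0 : 0 ≤ c)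
    (hc : ∀ x : J → ℝ, (S *ᵥ x) ⬝ᵥ (S *ᵥ x) ≤ c * (x ⬝ᵥ (S *ᵥ x))) (M : ℕ) :
    ∫ x, (x ⬝ᵥ (S *ᵥ x)) ^ M ∂stdGauss J ≤ (S.trace + 2 * M * c) ^ M := by
  -- M is kept fixed in the factor so that every step of the recursion multiplies by the same bound.
  have key : ∀ m ≤ M, ∫ x, (x ⬝ᵥ (S *ᵥ x)) ^ m ∂stdGauss J ≤ (S.trace + 2 * M * c) ^ m := by
    intro m
    induction m with
    | zero => simp
    | succ m ih =>
      intro hm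
      have htr : 0 ≤ S.trace := hS.trace_nonneg
      have hmM : (m : ℝ) ≤ M := by exact_mod_cast (by omega : m ≤ M)
      refine (integral_quadratic_pow_succ_le hS hc m).trans ?_
      rw [pow_succ']
      refine mul_le_mul (by gcongr) (ih (by omega)) ?_ (by positivity)
      refine integral_nonneg fun x => pow_nonneg ?_ _
      simpa using hS.dotProduct_mulVec_nonneg x
  exact key M le_rfl

omit [DecidableEq J] in
lemma dotProduct_mul_transpose_mulVec {R : Type*} [Fintype R] (B : J → R → ℝ) (x : J → ℝ) :
    x ⬝ᵥ ((of B * (of B)ᵀ) *ᵥ x) = ∑ r, (∑ a, x a * B a r) ^ 2 := by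
  rw [← mulVec_mulVec, dotProduct_mulVec, ← mulVec_transpose]
  simp only [dotProduct, mulVec, transpose_apply, of_apply]
  refine Finset.sum_congr rfl fun r _ => ?_
  rw [pow_two]
  simp_rw [mul_comm (B _ r)]

lemma trace_mul_transpose {L R : Type*} [Fintype L] [Fintype R] (B : Matrix L R ℝ) :
    (B * Bᵀ).trace = ∑ l, ∑ r, B l r ^ 2 := by
  simp [trace, mul_apply, pow_two]

lemma posSemidef_mul_transpose {L R : Type*} [Fintype L] [Fintype R] (B : Matrix L R ℝ) :
    (B * Bᵀ).PosSemidef := by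
  have := posSemidef_self_mul_conjTranspose B
  rwa [conjTranspose_eq_transpose_of_trivial] at this

lemma lintegral_norm_pow_le_of_bound {R : Type*} [Fintype R] (B : J → R → ℝ) {c : ℝ}
    (hc0 : 0 ≤ c) (hc : ∀ x : J → ℝ, ((of B * (of B)ᵀ) *ᵥ x) ⬝ᵥ ((of B * (of B)ᵀ) *ᵥ x) ≤
      c * (x ⬝ᵥ ((of B * (of B)ᵀ) *ᵥ x))) (M : ℕ) :
    ∫⁻ x, ENNReal.ofReal ((∑ r, (∑ a, x a * B a r) ^ 2) ^ M) ∂stdGauss J ≤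
      ENNReal.ofReal (((∑ a, ∑ r, B a r ^ 2) + 2 * M * c) ^ M) := by
  have h := integral_quadratic_pow_le (posSemidef_mul_transpose (of B)) hc0 hc M
  rw [trace_mul_transpose] at h
  simp_rw [dotProduct_mul_transpose_mulVec] at h
  refine le_trans (le_of_eq ?_) (ENNReal.ofReal_le_ofReal h)
  rw [ofReal_integral_eq_lintegral_ofReal]
  · refine (integrable_eval_stdGauss ((∑ r, (∑ a, MvPolynomial.X a *
      MvPolynomial.C (B a r)) ^ 2) ^ M)).congr (Filter.Eventually.of_forall fun x => ?_)
    simp [map_sum]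
  · exact Filter.Eventually.of_forall fun x => by positivity

/-- Moments of the norm of a Gaussian vector, bounded by its Hilbert–Schmidt norm and a Schatten
norm of its covariance. -/
theorem lintegral_norm_pow_le {R : Type*} [Fintype R] (B : J → R → ℝ) {M : ℕ} (hM : 1 ≤ M) :
    ∫⁻ x, ENNReal.ofReal ((∑ r, (∑ a, x a * B a r) ^ 2) ^ M) ∂stdGauss J ≤
      ENNReal.ofReal (2 ^ M * (∑ a, ∑ r, B a r ^ 2) ^ M +
        (4 * M) ^ M * ((of B * (of B)ᵀ) ^ M).trace) := by
  obtain ⟨c, hc0, hcM, hc⟩ := exists_le_trace_pow (posSemidef_mul_transpose (of B)) hM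
  refine (lintegral_norm_pow_le_of_bound B hc0 hc M).trans (ENNReal.ofReal_le_ofReal ?_)
  have h0 : 0 ≤ ∑ a, ∑ r, B a r ^ 2 := by positivity
  refine (add_pow_le h0 (by positivity : (0 : ℝ) ≤ 2 * M * c) M).trans ?_
  have h2 : (2 : ℝ) ^ (M - 1) ≤ 2 ^ M := pow_le_pow_right₀ one_le_two (by omega)
  calc _ ≤ 2 ^ M * ((∑ a, ∑ r, B a r ^ 2) ^ M + (2 * M * c) ^ M) := by gcongr
    _ = 2 ^ M * (∑ a, ∑ r, B a r ^ 2) ^ M + (4 * M) ^ M * c ^ M := by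
      rw [mul_add, ← mul_pow, ← mul_pow, ← mul_pow]
      congr 2; ring
    _ ≤ _ := by gcongr

/-- The rank-one case S = b bᵀ, with c = tr S = |b|²; the constant is 1 + 2M ≤ 3M. -/
theorem lintegral_linear_pow_le (b : J → ℝ) {M : ℕ} (hM : 1 ≤ M) :
    ∫⁻ x, ENNReal.ofReal ((∑ a, x a * b a) ^ (2 * M)) ∂stdGauss J ≤
      ENNReal.ofReal ((3 * M) ^ M * (∑ a, b a ^ 2) ^ M) := by
  have h0 : 0 ≤ ∑ a, b a ^ 2 := by positivity
  have h := lintegral_norm_pow_le_of_bound (R := Unit) (fun a _ => b a) h0 (fun x => ?_) M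
  · simp only [Finset.univ_unique, Finset.sum_singleton, ← pow_mul] at h
    refine h.trans (ENNReal.ofReal_le_ofReal ?_)
    rw [← mul_pow]
    have hM' : (1 : ℝ) ≤ M := by exact_mod_cast hM
    refine pow_le_pow_left₀ (by positivity) ?_ _
    nlinarith
  · rw [dotProduct_mul_transpose_mulVec]
    have : (of (fun a (_ : Unit) => b a) * (of fun a (_ : Unit) => b a)ᵀ) *ᵥ x =
        fun a => (∑ a, x a * b a) * b a := by
      ext a
      rw [← mulVec_mulVec]
      simp only [mulVec, dotProduct, transpose_apply, of_apply, Finset.univ_unique,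
        Finset.sum_singleton]
      rw [mul_comm]
      simp_rw [mul_comm (b _)]
    rw [this]
    simp only [dotProduct, Finset.univ_unique, Finset.sum_singleton]
    rw [Finset.sum_mul]
    refine le_of_eq (Finset.sum_congr rfl fun a _ => ?_)
    ring

end Quadratic

end

/-! ### Integrating out one leg of a tensor -/

section

open Matrix

section Contract

variable {J : Type} [Fintype J] {m : ℕ}

/-- The contraction of all legs of a tensor with the vectors `G 0, …, G (m - 1)`. -/
def contract {V : Type*} [AddCommMonoid V] [Module ℝ V] (T : (Fin m → J) → V)
    (G : Fin m → J → ℝ) : V :=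
  ∑ i, (∏ l, G l (i l)) • T i

lemma contract_snoc {V : Type*} [AddCommMonoid V] [Module ℝ V] (T : (Fin (m + 1) → J) → V)
    (G : Fin m → J → ℝ) (x : J → ℝ) :
    contract T (Fin.snoc G x : Fin (m + 1) → J → ℝ) =
      ∑ a, x a • contract (fun i => T (Fin.snoc i a)) G := by
  simp only [contract, Finset.smul_sum]
  rw [← (Fin.snocEquiv (fun _ : Fin (m + 1) => J)).sum_comp, Fintype.sum_prod_type]
  refine Finset.sum_congr rfl fun a _ => Finset.sum_congr rfl fun i _ => ?_
  simp [Fin.snocEquiv, Fin.prod_univ_castSucc, smul_smul, mul_comm]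

lemma contract_apply {R : Type*} (T : (Fin m → J) → R → ℝ) (G : Fin m → J → ℝ) (r : R) :
    contract T G r = contract (fun i => T i r) G := by
  simp [contract, Finset.sum_apply]

lemma contract_matrix_apply {L R : Type*} (T : (Fin m → J) → Matrix L R ℝ) (G : Fin m → J → ℝ)
    (l : L) (r : R) : contract T G l r = contract (fun i => T i l r) G := by
  simp [contract, Matrix.sum_apply]

lemma continuous_contract_real (T : (Fin m → J) → ℝ) : Continuous (contract T) := by
  unfold contract
  fun_prop

lemma continuous_contract_fun {R : Type*} (T : (Fin m → J) → R → ℝ) :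
    Continuous (contract T) :=
  continuous_pi fun r => by
    simp_rw [contract_apply]
    exact continuous_contract_real _

lemma continuous_contract_matrix {L R : Type*} (T : (Fin m → J) → Matrix L R ℝ) :
    Continuous (contract T) :=
  continuous_matrix fun l r => by
    simp_rw [contract_matrix_apply]
    exact continuous_contract_real _

lemma lintegral_pi_succ_eq {E : Type*} [MeasurableSpace E] (μ : Measure E) [SigmaFinite μ]
    {F : (Fin (m + 1) → E) → ENNReal} (hF : Measurable F) :
    ∫⁻ G, F G ∂Measure.pi (fun _ => μ) =
      ∫⁻ G, ∫⁻ x, F (Fin.snoc G x) ∂μ ∂Measure.pi (fun _ : Fin m => μ) := by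
  have h := (measurePreserving_piFinSuccAbove (fun _ : Fin (m + 1) => μ) (Fin.last m)).symm
  rw [← h.lintegral_comp hF, lintegral_prod_symm]
  · simp only [MeasurableEquiv.piFinSuccAbove_symm_apply, ← Fin.insertNth_last']
    rfl
  · exact (hF.comp (MeasurableEquiv.measurable _)).aemeasurable

end Contract

section Trace

variable {J : Type} [Fintype J] {L R : Type} [Fintype L] [Fintype R] [DecidableEq L]

/-- The trace `tr (B Bᵀ)ᴹ` as an extended nonnegative real number. -/
def traceMoment (M : ℕ) (B : Matrix L R ℝ) : ENNReal :=
  ENNReal.ofReal ((B * Bᵀ) ^ M).trace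

lemma continuous_traceMoment (M : ℕ) :
    Continuous (traceMoment M : Matrix L R ℝ → ENNReal) := by
  unfold traceMoment
  refine ENNReal.continuous_ofReal.comp (Continuous.matrix_trace ?_)
  exact (Continuous.matrix_mul continuous_id (Continuous.matrix_transpose continuous_id)).pow M

/-- The matrices of a family of matrices, put side by side. -/
def rowMatrix (B : J → Matrix L R ℝ) : Matrix L (J × R) ℝ := of fun l p => B p.1 l p.2

omit [Fintype L] [DecidableEq L] in
lemma rowMatrix_mul_transpose (B : J → Matrix L R ℝ) :
    rowMatrix B * (rowMatrix B)ᵀ = ∑ a, B a * (B a)ᵀ := by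
  ext l l'
  simp [rowMatrix, mul_apply, Matrix.sum_apply, Fintype.sum_prod_type]

lemma lintegral_traceMoment_le [DecidableEq R] (B : J → Matrix L R ℝ) {M : ℕ} (hM : 1 ≤ M) :
    ∫⁻ x, traceMoment M (∑ a, x a • B a) ∂stdGauss J ≤
      ENNReal.ofReal ((8 * M) ^ M) * (traceMoment M (rowMatrix B) +
        traceMoment M (rowMatrix fun a => (B a)ᵀ)) := by
  refine (lintegral_trace_mul_transpose_pow_le B hM).trans (le_of_eq ?_)
  rw [ENNReal.ofReal_mul (by positivity), ENNReal.ofReal_add]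
  · simp only [traceMoment, rowMatrix_mul_transpose, transpose_transpose]
  · rw [← rowMatrix_mul_transpose]
    exact ((posSemidef_mul_transpose _).pow M).trace_nonneg
  · have := rowMatrix_mul_transpose (fun a => (B a)ᵀ)
    simp only [transpose_transpose] at this
    rw [← this]
    exact ((posSemidef_mul_transpose _).pow M).trace_nonneg

variable {m : ℕ}

/-- Moving the last leg of a tensor with matrix values to the columns. -/
def rowTensor (T : (Fin (m + 1) → J) → Matrix L R ℝ) : (Fin m → J) → Matrix L (J × R) ℝ :=
  fun i => rowMatrix fun a => T (Fin.snoc i a)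

omit [Fintype L] [Fintype R] [DecidableEq L] in
lemma contract_rowTensor (T : (Fin (m + 1) → J) → Matrix L R ℝ) (G : Fin m → J → ℝ) :
    contract (rowTensor T) G = rowMatrix fun a => contract (fun i => T (Fin.snoc i a)) G := by
  ext l p
  simp [contract, rowTensor, rowMatrix, Matrix.sum_apply]

/-- With the other vectors frozen, the contraction is a Gaussian matrix in the last vector. The two
Khintchine terms attach the last leg to the columns or, after transposition, to the rows. -/
lemma lintegral_traceMoment_contract_succ_le [DecidableEq R]
    (T : (Fin (m + 1) → J) → Matrix L R ℝ) {M : ℕ} (hM : 1 ≤ M) :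
    ∫⁻ G, traceMoment M (contract T G) ∂Measure.pi (fun _ => stdGauss J) ≤
      ENNReal.ofReal ((8 * M) ^ M) *
        (∫⁻ G, traceMoment M (contract (rowTensor T) G) ∂Measure.pi (fun _ => stdGauss J) +
        ∫⁻ G, traceMoment M (contract (rowTensor fun i => (T i)ᵀ) G)
          ∂Measure.pi (fun _ => stdGauss J)) := by
  rw [lintegral_pi_succ_eq (F := fun G => traceMoment M (contract T G)) _
    ((continuous_traceMoment M).comp (continuous_contract_matrix T)).measurable,
    ← lintegral_add_left (f := fun G => traceMoment M (contract (rowTensor T) G))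
    ((continuous_traceMoment M).comp (continuous_contract_matrix (rowTensor T))).measurable,
    ← lintegral_const_mul' _ _ ENNReal.ofReal_ne_top]
  refine lintegral_mono fun G => ?_
  simp_rw [contract_snoc]
  refine (lintegral_traceMoment_le _ hM).trans (le_of_eq ?_)
  simp only [contract_rowTensor]
  congr 4
  ext a l p
  simp [contract, Matrix.sum_apply]

end Trace

section Norm

variable {J : Type} [Fintype J] {R : Type} [Fintype R] {m : ℕ}

/-- The power `|v|²ᴹ` of the Euclidean norm as an extended nonnegative real number. -/
def normMoment (M : ℕ) (v : R → ℝ) : ENNReal := ENNReal.ofReal ((∑ r, v r ^ 2) ^ M)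

lemma continuous_normMoment (M : ℕ) : Continuous (normMoment M : (R → ℝ) → ENNReal) := by
  unfold normMoment
  exact ENNReal.continuous_ofReal.comp (by fun_prop)

/-- Moving the last leg of a tensor with vector values to the coordinates of the vectors. -/
def flattenTensor (T : (Fin (m + 1) → J) → R → ℝ) : (Fin m → J) → (J × R) → ℝ :=
  fun i p => T (Fin.snoc i p.1) p.2

/-- Moving the last leg of a tensor with vector values to the rows of matrices. -/
def matrixTensor (T : (Fin (m + 1) → J) → R → ℝ) : (Fin m → J) → Matrix J R ℝ :=
  fun i => of fun a => T (Fin.snoc i a)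

/-- With the other vectors frozen, the Hilbert–Schmidt term makes the last leg a coordinate leg, and
the Schatten term makes it the row leg of a matrix. -/
lemma lintegral_normMoment_contract_succ_le [DecidableEq J] (T : (Fin (m + 1) → J) → R → ℝ)
    {M : ℕ} (hM : 1 ≤ M) :
    ∫⁻ G, normMoment M (contract T G) ∂Measure.pi (fun _ => stdGauss J) ≤
      ENNReal.ofReal (2 ^ M) *
        ∫⁻ G, normMoment M (contract (flattenTensor T) G) ∂Measure.pi (fun _ => stdGauss J) +
      ENNReal.ofReal ((4 * M) ^ M) *
        ∫⁻ G, traceMoment M (contract (matrixTensor T) G) ∂Measure.pi (fun _ => stdGauss J) := by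
  rw [lintegral_pi_succ_eq (F := fun G => normMoment M (contract T G)) _
    ((continuous_normMoment M).comp (continuous_contract_fun T)).measurable,
    ← lintegral_const_mul' _ _ ENNReal.ofReal_ne_top,
    ← lintegral_const_mul' _ _ ENNReal.ofReal_ne_top,
    ← lintegral_add_left (f := fun G => ENNReal.ofReal (2 ^ M) *
      normMoment M (contract (flattenTensor T) G)) (((continuous_normMoment M).comp
      (continuous_contract_fun (flattenTensor T))).measurable.const_mul _)]
  refine lintegral_mono fun G => ?_
  simp_rw [contract_snoc]
  set B : J → R → ℝ := fun a => contract (fun i => T (Fin.snoc i a)) G with hB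
  have e1 : contract (flattenTensor T) G = fun p => B p.1 p.2 := by
    ext p
    simp only [hB, contract_apply]
    rfl
  have e2 : contract (matrixTensor T) G = of B := by
    ext a r
    simp only [hB, contract_matrix_apply, of_apply, contract_apply]
    rfl
  have h := lintegral_norm_pow_le B hM
  rw [ENNReal.ofReal_add (by positivity) (mul_nonneg (by positivity)
      ((posSemidef_mul_transpose _).pow M).trace_nonneg),
    ENNReal.ofReal_mul (by positivity), ENNReal.ofReal_mul (by positivity)] at h
  simp only [normMoment, traceMoment, e1, e2, Fintype.sum_prod_type]
  simpa [Finset.sum_apply] using h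

lemma lintegral_pow_contract_succ_le [DecidableEq J] (T : (Fin (m + 1) → J) → ℝ)
    {M : ℕ} (hM : 1 ≤ M) :
    ∫⁻ G, ENNReal.ofReal (contract T G ^ (2 * M)) ∂Measure.pi (fun _ => stdGauss J) ≤
      ENNReal.ofReal ((3 * M) ^ M) *
        ∫⁻ G, normMoment M (contract (fun i a => T (Fin.snoc i a)) G)
          ∂Measure.pi (fun _ => stdGauss J) := by
  rw [lintegral_pi_succ_eq (F := fun G => ENNReal.ofReal (contract T G ^ (2 * M))) _
    (ENNReal.continuous_ofReal.comp
    ((continuous_contract_real T).pow _)).measurable,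
    ← lintegral_const_mul' _ _ ENNReal.ofReal_ne_top]
  refine lintegral_mono fun G => ?_
  simp_rw [contract_snoc, smul_eq_mul]
  refine (lintegral_linear_pow_le _ hM).trans (le_of_eq ?_)
  rw [ENNReal.ofReal_mul (by positivity)]
  simp only [normMoment, contract_apply]

end Norm

end

/-! ### Block bounds and the recursion over open legs -/

section

open Matrix

/-- The tensor `c` has Hilbert–Schmidt norm at most `1`, and every matrix obtained from it by
splitting its legs into two nonempty classes has operator norm at most `ρ`. -/
structure HasBlockBounds {J : Type} [Fintype J] {k : ℕ} (c : (Fin k → J) → ℝ) (ρ : ℝ) : Prop where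
  sum_sq_le : ∑ i, c i ^ 2 ≤ 1
  bilinear_le : ∀ (A B : Type) [Fintype A] [Fintype B] [DecidableEq A] [DecidableEq B] [Nonempty A]
    [Nonempty B] (e : A ⊕ B ≃ Fin k) (u : (A → J) → ℝ) (v : (B → J) → ℝ),
    ∑ a, u a ^ 2 ≤ 1 → ∑ b, v b ^ 2 ≤ 1 →
      ∑ i, c i * (u (fun a => i (e (Sum.inl a))) * v (fun b => i (e (Sum.inr b)))) ≤ ρ

section Legs

variable {J : Type} {k : ℕ}

/-- The last leg is made an additional element of the second class. -/
def moveLast (m : ℕ) (A B : Type) : Fin m ⊕ (A ⊕ Option B) ≃ Fin (m + 1) ⊕ (A ⊕ B) where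
  toFun := Sum.elim (fun i => Sum.inl i.castSucc) (Sum.elim (fun a => Sum.inr (Sum.inl a))
    (fun b => b.elim (Sum.inl (Fin.last m)) (fun b => Sum.inr (Sum.inr b))))
  invFun := Sum.elim (fun j => Fin.lastCases (motive := fun _ => Fin m ⊕ (A ⊕ Option B))
    (Sum.inr (Sum.inr none)) (fun i => Sum.inl i) j)
    (Sum.elim (fun a => Sum.inr (Sum.inl a)) (fun b => Sum.inr (Sum.inr (some b))))
  left_inv := by
    rintro (i | a | _ | b) <;> simp
  right_inv := by
    rintro (j | a | b)
    · induction j using Fin.lastCases <;> simp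
    · simp
    · simp

/-- The last leg is made an additional element of the class. -/
def moveLast' (m : ℕ) (B : Type) : Fin m ⊕ Option B ≃ Fin (m + 1) ⊕ B where
  toFun := Sum.elim (fun i => Sum.inl i.castSucc)
    (fun b => b.elim (Sum.inl (Fin.last m)) (fun b => Sum.inr b))
  invFun := Sum.elim (fun j => Fin.lastCases (motive := fun _ => Fin m ⊕ Option B)
    (Sum.inr none) (fun i => Sum.inl i) j) (fun b => Sum.inr (some b))
  left_inv := by
    rintro (i | _ | b) <;> simp
  right_inv := by
    rintro (j | b)
    · induction j using Fin.lastCases <;> simp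
    · simp

/-- The last leg is made a class of its own. -/
def splitLast (m : ℕ) (B : Type) : Fin m ⊕ (Unit ⊕ B) ≃ Fin (m + 1) ⊕ B where
  toFun := Sum.elim (fun i => Sum.inl i.castSucc)
    (Sum.elim (fun _ => Sum.inl (Fin.last m)) (fun b => Sum.inr b))
  invFun := Sum.elim (fun j => Fin.lastCases (motive := fun _ => Fin m ⊕ (Unit ⊕ B))
    (Sum.inr (Sum.inl ())) (fun i => Sum.inl i) j) (fun b => Sum.inr (Sum.inr b))
  left_inv := by
    rintro (i | _ | b) <;> simp
  right_inv := by
    rintro (j | b)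
    · induction j using Fin.lastCases <;> simp
    · simp

/-- The matrix-valued tensor `T` is obtained from `c` by sorting the legs into open legs, row legs
`A` and column legs `B`. -/
def IsMatricization (c : (Fin k → J) → ℝ) {m : ℕ} {A B L R : Type} (e : Fin m ⊕ (A ⊕ B) ≃ Fin k)
    (eL : L ≃ (A → J)) (eR : R ≃ (B → J)) (T : (Fin m → J) → Matrix L R ℝ) : Prop :=
  ∀ i l r, T i l r = c (fun q => Sum.elim i (Sum.elim (eL l) (eR r)) (e.symm q))

/-- The vector-valued tensor `T` is obtained from `c` by sorting the legs into open legs and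
coordinate legs `B`. -/
def IsVectorization (c : (Fin k → J) → ℝ) {m : ℕ} {B R : Type} (e : Fin m ⊕ B ≃ Fin k)
    (eR : R ≃ (B → J)) (T : (Fin m → J) → R → ℝ) : Prop :=
  ∀ i r, T i r = c (fun q => Sum.elim i (eR r) (e.symm q))

variable {c : (Fin k → J) → ℝ} {m : ℕ} {A B L R : Type}

lemma IsMatricization.transpose {e : Fin m ⊕ (A ⊕ B) ≃ Fin k} {eL : L ≃ (A → J)}
    {eR : R ≃ (B → J)} {T : (Fin m → J) → Matrix L R ℝ} (h : IsMatricization c e eL eR T) :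
    IsMatricization c (((Equiv.refl _).sumCongr (Equiv.sumComm B A)).trans e) eR eL
      (fun i => (T i)ᵀ) := by
  intro i r l
  change T i l r = _
  rw [h]
  congr 1
  ext q
  rcases h' : e.symm q with (j | a | b) <;> simp [h']

lemma IsMatricization.rowTensor {e : Fin (m + 1) ⊕ (A ⊕ B) ≃ Fin k} {eL : L ≃ (A → J)}
    {eR : R ≃ (B → J)} {T : (Fin (m + 1) → J) → Matrix L R ℝ} (h : IsMatricization c e eL eR T) :
    IsMatricization c ((moveLast m A B).trans e) eL
      (((Equiv.refl J).prodCongr eR).trans (Equiv.piOptionEquivProd (β := fun _ => J)).symm)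
      (rowTensor T) := by
  rintro i l ⟨a, r⟩
  rw [WienerIto.rowTensor, rowMatrix, of_apply, h]
  congr 1
  ext q
  rcases h' : e.symm q with (j | a | b)
  · induction j using Fin.lastCases <;> simp [h', moveLast, Equiv.piOptionEquivProd]
  · simp [h', moveLast]
  · simp [h', moveLast, Equiv.piOptionEquivProd]

lemma IsVectorization.flattenTensor {e : Fin (m + 1) ⊕ B ≃ Fin k}
    {eR : R ≃ (B → J)} {T : (Fin (m + 1) → J) → R → ℝ} (h : IsVectorization c e eR T) :
    IsVectorization c ((moveLast' m B).trans e)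
      (((Equiv.refl J).prodCongr eR).trans (Equiv.piOptionEquivProd (β := fun _ => J)).symm)
      (flattenTensor T) := by
  rintro i ⟨a, r⟩
  rw [WienerIto.flattenTensor, h]
  congr 1
  ext q
  rcases h' : e.symm q with (j | b)
  · induction j using Fin.lastCases <;> simp [h', moveLast', Equiv.piOptionEquivProd]
  · simp [h', moveLast', Equiv.piOptionEquivProd]

lemma IsVectorization.matrixTensor {e : Fin (m + 1) ⊕ B ≃ Fin k}
    {eR : R ≃ (B → J)} {T : (Fin (m + 1) → J) → R → ℝ} (h : IsVectorization c e eR T) :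
    IsMatricization c ((splitLast m B).trans e) (Equiv.funUnique Unit J).symm eR
      (matrixTensor T) := by
  intro i a r
  rw [WienerIto.matrixTensor, of_apply, h]
  congr 1
  ext q
  rcases h' : e.symm q with (j | b)
  · induction j using Fin.lastCases <;> simp [h', splitLast]
  · simp [h', splitLast]

end Legs

section Bounds

variable {J : Type} [Fintype J] {k : ℕ} {c : (Fin k → J) → ℝ} {ρ : ℝ}

lemma HasBlockBounds.rho_nonneg (hc : HasBlockBounds c ρ) (hk : 2 ≤ k) : 0 ≤ ρ := by
  have e : Fin 1 ⊕ Fin (k - 1) ≃ Fin k := finSumFinEquiv.trans (finCongr (by omega))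
  have : Nonempty (Fin (k - 1)) := ⟨⟨0, by omega⟩⟩
  have := hc.bilinear_le (Fin 1) (Fin (k - 1)) e 0 0 (by simp) (by simp)
  simpa using this

/-- With no open leg, the matrix is c with its legs split into two classes: its squared operator
norm is at most ρ² and its squared Hilbert–Schmidt norm at most 1. -/
lemma HasBlockBounds.trace_pow_le (hc : HasBlockBounds c ρ) (_hρ : 0 ≤ ρ) {A B L R : Type}
    [Fintype A] [Fintype B] [DecidableEq A] [DecidableEq B] [Nonempty A] [Nonempty B] [Fintype L]
    [Fintype R] [DecidableEq L] {e : Fin 0 ⊕ (A ⊕ B) ≃ Fin k}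
    {eL : L ≃ (A → J)} {eR : R ≃ (B → J)} {T : (Fin 0 → J) → Matrix L R ℝ}
    (h : IsMatricization c e eL eR T) (i : Fin 0 → J) {M : ℕ} (hM : 1 ≤ M) :
    ((T i * (T i)ᵀ) ^ M).trace ≤ (ρ ^ 2) ^ (M - 1) := by
  obtain ⟨N, rfl⟩ : ∃ N, M = N + 1 := ⟨M - 1, by omega⟩
  set e' : A ⊕ B ≃ Fin k := (Equiv.emptySum (Fin 0) (A ⊕ B)).symm.trans e with he'
  have hT : ∀ l r, T i l r = c (fun q => Sum.elim (eL l) (eR r) (e'.symm q)) := by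
    intro l r
    rw [h]
    congr 1
    ext q
    rcases h' : e.symm q with (j | z)
    · exact j.elim0
    · simp [he', h']
  set E : L × R ≃ (Fin k → J) := ((eL.prodCongr eR).trans
    (Equiv.sumArrowEquivProdArrow A B J).symm).trans (e'.arrowCongr (Equiv.refl J)) with hE
  have hEa : ∀ p q, E p q = Sum.elim (eL p.1) (eR p.2) (e'.symm q) := fun p q => rfl
  have hT' : ∀ l r, T i l r = c (E (l, r)) := fun l r => hT l r
  have htr : (T i * (T i)ᵀ).trace ≤ 1 := by
    rw [trace_mul_transpose, ← Fintype.sum_prod_type' (fun l r => T i l r ^ 2)]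
    simp_rw [hT']
    rw [E.sum_comp (fun i => c i ^ 2)]
    exact hc.sum_sq_le
  have hbil : ∀ (x : L → ℝ) (y : R → ℝ), ∑ l, x l ^ 2 ≤ 1 → ∑ r, y r ^ 2 ≤ 1 →
      ∑ l, ∑ r, T i l r * (x l * y r) ≤ ρ := by
    intro x y hx hy
    have := hc.bilinear_le A B e' (fun a => x (eL.symm a)) (fun b => y (eR.symm b))
      (by rwa [eL.symm.sum_comp (fun l => x l ^ 2)]) (by rwa [eR.symm.sum_comp (fun l => y l ^ 2)])
    rw [← E.sum_comp, Fintype.sum_prod_type] at this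
    simpa [hEa, hT'] using this
  have hop : ∀ x : L → ℝ, x ⬝ᵥ ((T i * (T i)ᵀ) *ᵥ x) ≤ ρ ^ 2 * (x ⬝ᵥ x) := by
    intro x
    -- The test vector y = Tᵀx is extremal for the bilinear form.
    set y : R → ℝ := fun r => ∑ l, x l * T i l r with hy
    have h1 : x ⬝ᵥ ((T i * (T i)ᵀ) *ᵥ x) = ∑ r, y r ^ 2 :=
      dotProduct_mul_transpose_mulVec (fun l r => T i l r) x
    have h2 : x ⬝ᵥ x = ∑ l, x l ^ 2 := by simp [dotProduct, pow_two]
    have h3 : ∑ l, ∑ r, T i l r * (x l * y r) = ∑ r, y r ^ 2 := by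
      rw [Finset.sum_comm]
      refine Finset.sum_congr rfl fun r _ => ?_
      rw [pow_two]
      nth_rewrite 2 [hy]
      rw [Finset.sum_mul]
      exact Finset.sum_congr rfl fun l _ => by ring
    rw [h1, h2]
    set a := √(∑ l, x l ^ 2) with ha
    set b := √(∑ r, y r ^ 2) with hb
    have ha2 : a ^ 2 = ∑ l, x l ^ 2 := Real.sq_sqrt (by positivity)
    have hb2 : b ^ 2 = ∑ r, y r ^ 2 := Real.sq_sqrt (by positivity)
    have ha0 : 0 ≤ a := Real.sqrt_nonneg _
    have hb0 : 0 ≤ b := Real.sqrt_nonneg _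
    -- Division by zero yields the zero vector, so the normalized vectors are admissible even when a
    -- or b vanishes; these cases are separated below.
    have h4 := hbil (fun l => x l / a) (fun r => y r / b)
      (by simp_rw [div_pow]; rw [← Finset.sum_div, ← ha2]; exact div_self_le_one _)
      (by simp_rw [div_pow]; rw [← Finset.sum_div, ← hb2]; exact div_self_le_one _)
    have h5 : ∑ l, ∑ r, T i l r * (x l / a * (y r / b)) = b ^ 2 / (a * b) := by
      rw [hb2, ← h3, Finset.sum_div]
      refine Finset.sum_congr rfl fun l _ => ?_
      rw [Finset.sum_div]
      refine Finset.sum_congr rfl fun r _ => ?_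
      rw [div_mul_div_comm, ← mul_div_assoc]
    rw [h5] at h4
    rw [← ha2, ← hb2]
    rcases hb0.eq_or_lt with hb' | hb'
    · rw [← hb', zero_pow two_ne_zero]; positivity
    rcases ha0.eq_or_lt with ha' | ha'
    · have hx : ∀ l, x l = 0 := by
        have : ∑ l, x l ^ 2 = 0 := by rw [← ha2, ← ha']; simp
        intro l
        have := (Finset.sum_eq_zero_iff_of_nonneg (fun l _ => sq_nonneg (x l))).1 this l
          (Finset.mem_univ l)
        exact pow_eq_zero_iff two_ne_zero |>.1 this
      have : ∑ r, y r ^ 2 = 0 := by simp [hy, hx]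
      rw [hb2, this]; positivity
    rw [div_le_iff₀ (by positivity)] at h4
    have h6 : b ≤ ρ * a := by
      have : b * b ≤ (ρ * a) * b := by nlinarith
      exact le_of_mul_le_mul_right this hb'
    rw [← mul_pow]
    exact pow_le_pow_left₀ hb0 h6 2
  refine (trace_pow_le_of_dotProduct_le (posSemidef_mul_transpose _) hop N).trans ?_
  rw [Nat.add_sub_cancel]
  exact mul_le_of_le_one_right (by positivity) htr

lemma lintegral_pi_fin_zero {E : Type*} [MeasurableSpace E] (μ : Measure E) [SigmaFinite μ]
    (F : (Fin 0 → E) → ENNReal) :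
    ∫⁻ G, F G ∂Measure.pi (fun _ => μ) = F Fin.elim0 := by
  rw [Measure.pi_of_empty (fun _ : Fin 0 => μ) Fin.elim0, lintegral_dirac]

/-- Induction on the number of open legs, over all matricizations of c simultaneously, because each
step enlarges the row or the column class. The two resulting terms give 2(8M)^M ≤ (16M)^M. -/
theorem HasBlockBounds.lintegral_traceMoment_le (hc : HasBlockBounds c ρ) (hρ : 0 ≤ ρ)
    [DecidableEq J] {M : ℕ} (hM : 1 ≤ M) : ∀ (m : ℕ) {A B L R : Type}
    [Fintype A] [Fintype B] [DecidableEq A] [DecidableEq B] [Nonempty A] [Nonempty B] [Fintype L]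
    [Fintype R] [DecidableEq L] [DecidableEq R] {e : Fin m ⊕ (A ⊕ B) ≃ Fin k}
    {eL : L ≃ (A → J)} {eR : R ≃ (B → J)} {T : (Fin m → J) → Matrix L R ℝ}
    (_ : IsMatricization c e eL eR T),
    ∫⁻ G, traceMoment M (contract T G) ∂Measure.pi (fun _ => stdGauss J) ≤
      ENNReal.ofReal (((16 * M) ^ M) ^ m * (ρ ^ 2) ^ (M - 1))
  | 0, A, B, L, R, _, _, _, _, _, _, _, _, _, _, e, eL, eR, T, h => by
    rw [lintegral_pi_fin_zero]
    refine ENNReal.ofReal_le_ofReal ?_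
    have e : contract T Fin.elim0 = T Fin.elim0 := by
      simp only [contract, Finset.univ_eq_empty, Finset.prod_empty, one_smul]
      rw [Fintype.sum_unique]
      exact congrArg T (Subsingleton.elim _ _)
    rw [e, pow_zero, one_mul]
    exact hc.trace_pow_le hρ h _ hM
  | m + 1, A, B, L, R, _, _, _, _, _, _, _, _, _, _, e, eL, eR, T, h => by
    refine (lintegral_traceMoment_contract_succ_le T hM).trans ?_
    have h1 := HasBlockBounds.lintegral_traceMoment_le hc hρ hM m h.rowTensor
    have h2 := HasBlockBounds.lintegral_traceMoment_le hc hρ hM m h.transpose.rowTensor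
    refine (mul_le_mul_right (add_le_add h1 h2) _).trans ?_
    rw [← ENNReal.ofReal_add (by positivity) (by positivity), ← ENNReal.ofReal_mul (by positivity)]
    refine ENNReal.ofReal_le_ofReal ?_
    rw [pow_succ, ← two_mul]
    have h3 : (2 : ℝ) * (8 * M) ^ M ≤ (16 * M) ^ M := by
      rw [show (16 * M : ℝ) = 2 * (8 * M) by ring, mul_pow 2]
      refine mul_le_mul_of_nonneg_right ?_ (by positivity)
      exact le_self_pow₀ one_le_two (by omega)
    calc _ = (2 * (8 * M : ℝ) ^ M) * (((16 * M) ^ M) ^ m * (ρ ^ 2) ^ (M - 1)) := by ring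
      _ ≤ (16 * M) ^ M * (((16 * M) ^ M) ^ m * (ρ ^ 2) ^ (M - 1)) := by gcongr
      _ = _ := by ring

/-- The base 64 dominates 16 and leaves room for 2^M + 4^M ≤ 64^M. -/
lemma norm_moment_recursion_le (m M : ℕ) (hM : 1 ≤ M) {t : ℝ} (ht : 0 ≤ t) :
    2 ^ M * ((64 ^ M) ^ m * (1 + ((M : ℝ) ^ M) ^ m * t)) +
      (4 * M) ^ M * (((16 * M) ^ M) ^ m * t) ≤
      (64 ^ M) ^ (m + 1) * (1 + ((M : ℝ) ^ M) ^ (m + 1) * t) := by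
  have hM' : (1 : ℝ) ≤ M := by exact_mod_cast hM
  have hY : (1 : ℝ) ≤ (M : ℝ) ^ M := one_le_pow₀ hM'
  set Y := (M : ℝ) ^ M with hYdef
  have h16 : ((16 : ℝ) ^ M) ^ m ≤ (64 ^ M) ^ m := by gcongr; norm_num
  set D := ((64 : ℝ) ^ M) ^ m with hD
  have hD0 : 0 < D := by positivity
  have e1 : (4 * M : ℝ) ^ M * (((16 * M) ^ M) ^ m * t) = 4 ^ M * (16 ^ M) ^ m * (Y ^ (m + 1) * t) := by
    rw [mul_pow, mul_pow, mul_pow, pow_succ]; ring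
  have h24 : (2 : ℝ) ^ M + 4 ^ M ≤ 64 ^ M := by
    have h2 : (2 : ℝ) ^ M ≤ 4 ^ M := by gcongr; norm_num
    have h16' : (16 : ℝ) ≤ 16 ^ M := le_self_pow₀ (by norm_num) (by omega)
    have : (64 : ℝ) ^ M = 16 ^ M * 4 ^ M := by rw [← mul_pow]; norm_num
    rw [this]
    nlinarith [pow_pos (by norm_num : (0 : ℝ) < 4) M]
  have hYm : Y ^ m ≤ Y ^ (m + 1) := pow_le_pow_right₀ hY (by omega)
  have hZ : 0 ≤ Y ^ (m + 1) * t := by positivity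
  rw [e1]
  calc _ ≤ 2 ^ M * (D * (1 + Y ^ (m + 1) * t)) + 4 ^ M * D * (1 + Y ^ (m + 1) * t) := by
        gcongr
        linarith
    _ = (2 ^ M + 4 ^ M) * (D * (1 + Y ^ (m + 1) * t)) := by ring
    _ ≤ 64 ^ M * (D * (1 + Y ^ (m + 1) * t)) := by gcongr
    _ = _ := by rw [pow_succ (64 ^ M), ← hD]; ring

/-- If every open leg joins the coordinates, the Hilbert–Schmidt norm remains: this is the summand
1. Once a leg splits off a matrix, that leg and each later one cost M^M and the end is ρ^(2(M-1)).
-/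
theorem HasBlockBounds.lintegral_normMoment_le (hc : HasBlockBounds c ρ) (hρ : 0 ≤ ρ)
    [DecidableEq J] {M : ℕ} (hM : 1 ≤ M) : ∀ (m : ℕ) {B R : Type}
    [Fintype B] [DecidableEq B] [Nonempty B] [Fintype R] [DecidableEq R]
    {e : Fin m ⊕ B ≃ Fin k} {eR : R ≃ (B → J)} {T : (Fin m → J) → R → ℝ}
    (_ : IsVectorization c e eR T),
    ∫⁻ G, normMoment M (contract T G) ∂Measure.pi (fun _ => stdGauss J) ≤
      ENNReal.ofReal ((64 ^ M) ^ m * (1 + ((M : ℝ) ^ M) ^ m * (ρ ^ 2) ^ (M - 1)))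
  | 0, B, R, _, _, _, _, _, e, eR, T, h => by
    rw [lintegral_pi_fin_zero]
    refine ENNReal.ofReal_le_ofReal ?_
    set e' : B ≃ Fin k := (Equiv.emptySum (Fin 0) B).symm.trans e with he'
    have e1 : contract T Fin.elim0 = T Fin.elim0 := by
      simp only [contract, Finset.univ_eq_empty, Finset.prod_empty, one_smul]
      rw [Fintype.sum_unique]
      exact congrArg T (Subsingleton.elim _ _)
    have e2 : ∀ r, T Fin.elim0 r = c ((eR.trans (e'.arrowCongr (Equiv.refl J))) r) := by
      intro r
      rw [h]
      congr 1
      ext q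
      rcases h' : e.symm q with (j | z)
      · exact j.elim0
      · simp [he', h', Equiv.arrowCongr]
    have e3 : ∑ r, T Fin.elim0 r ^ 2 ≤ 1 := by
      simp_rw [e2]
      rw [(eR.trans (e'.arrowCongr (Equiv.refl J))).sum_comp (fun i => c i ^ 2)]
      exact hc.sum_sq_le
    rw [e1, pow_zero, pow_zero, one_mul, one_mul]
    have : (∑ r, T Fin.elim0 r ^ 2) ^ M ≤ 1 := pow_le_one₀ (by positivity) e3
    have : 0 ≤ (ρ ^ 2) ^ (M - 1) := by positivity
    linarith
  | m + 1, B, R, _, _, _, _, _, e, eR, T, h => by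
    refine (lintegral_normMoment_contract_succ_le T hM).trans ?_
    have h1 := HasBlockBounds.lintegral_normMoment_le hc hρ hM m h.flattenTensor
    have h2 := hc.lintegral_traceMoment_le hρ hM m h.matrixTensor
    refine (add_le_add (mul_le_mul_right h1 _) (mul_le_mul_right h2 _)).trans ?_
    rw [← ENNReal.ofReal_mul (by positivity), ← ENNReal.ofReal_mul (by positivity),
      ← ENNReal.ofReal_add (by positivity) (by positivity)]
    exact ENNReal.ofReal_le_ofReal (norm_moment_recursion_le m M hM (by positivity))

/-- The last leg becomes the only coordinate leg, so K open legs remain for the norm recursion. -/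
theorem HasBlockBounds.lintegral_contract_pow_le [DecidableEq J] {K : ℕ}
    {c : (Fin (K + 1) → J) → ℝ} (hc : HasBlockBounds c ρ) (hρ : 0 ≤ ρ) {M : ℕ} (hM : 1 ≤ M) :
    ∫⁻ G, ENNReal.ofReal (contract c G ^ (2 * M)) ∂Measure.pi (fun _ => stdGauss J) ≤
      ENNReal.ofReal ((3 * M) ^ M *
        ((64 ^ M) ^ K * (1 + ((M : ℝ) ^ M) ^ K * (ρ ^ 2) ^ (M - 1)))) := by
  refine (lintegral_pow_contract_succ_le c hM).trans ?_
  have h := hc.lintegral_normMoment_le hρ hM K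
    (e := ((Equiv.refl _).sumCongr (finOneEquiv).symm).trans finSumFinEquiv)
    (eR := (Equiv.funUnique Unit J).symm) (T := fun i a => c (Fin.snoc i a)) (by
      intro i a
      refine congrArg c (funext fun q => ?_)
      induction q using Fin.lastCases with
      | last => simp [finSumFinEquiv, Fin.addCases]
      | cast q => simp [finSumFinEquiv, Fin.addCases])
  refine (mul_le_mul_right h _).trans (le_of_eq ?_)
  rw [← ENNReal.ofReal_mul (by positivity)]

end Bounds

end

/-! ### Decoupling by coloring the variables -/

section Decoupling

variable {J : Type} [Fintype J] [DecidableEq J] {k : ℕ}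

/-- The homogeneous polynomial with coefficients `c`. -/
def chaosPoly (c : (Fin k → J) → ℝ) (g : J → ℝ) : ℝ := ∑ i, c i * ∏ l, g (i l)

/-- The part of the coefficients compatible with a coloring of the variables. -/
def colored (c : (Fin k → J) → ℝ) (δ : J → Fin k) (i : Fin k → J) : ℝ :=
  if ∀ l, δ (i l) = l then c i else 0

/-- The color is forced at the k distinct values of i and free elsewhere. -/
lemma card_coloring_mul {i : Fin k → J} (hi : Function.Injective i) :
    (Finset.univ.filter fun δ : J → Fin k => ∀ l, δ (i l) = l).card * k ^ k =
      k ^ Fintype.card J := by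
  set I : Finset J := Finset.univ.map ⟨i, hi⟩ with hI
  have hIc : I.card = k := by simp [hI]
  have e : (Finset.univ.filter fun δ : J → Fin k => ∀ l, δ (i l) = l) =
      Fintype.piFinset fun j => Finset.univ.filter fun q : Fin k => ∀ l, i l = j → q = l := by
    ext δ
    simp only [Finset.mem_filter, Finset.mem_univ, true_and, Fintype.mem_piFinset]
    exact ⟨fun h j l hl => hl ▸ h l, fun h l => h _ l rfl⟩
  have hcard : ∀ j, (Finset.univ.filter fun q : Fin k => ∀ l, i l = j → q = l).card =
      if j ∈ I then 1 else k := by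
    intro j
    split_ifs with hj
    · obtain ⟨l, -, rfl⟩ := Finset.mem_map.1 hj
      rw [Finset.card_eq_one]
      refine ⟨l, ?_⟩
      ext q
      simp only [Finset.mem_filter, Finset.mem_univ, true_and, Finset.mem_singleton]
      exact ⟨fun h => h l rfl, fun h l' hl' => h.trans (hi hl').symm⟩
    · rw [Finset.filter_true_of_mem, Finset.card_univ, Fintype.card_fin]
      intro q _ l hl
      exact absurd (Finset.mem_map.2 ⟨l, Finset.mem_univ _, hl⟩) hj
  rw [e, Fintype.card_piFinset]
  simp_rw [hcard]
  rw [Finset.prod_ite, Finset.prod_const_one, one_mul, Finset.prod_const, ← pow_add]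
  congr 1
  have : (Finset.univ.filter fun j => j ∉ I).card = Fintype.card J - k := by
    rw [← Finset.compl_filter, Finset.card_compl]
    simp [hIc]
  rw [this]
  have : k ≤ Fintype.card J := by
    rw [← hIc]; exact Finset.card_le_univ I
  omega

lemma sum_chaosPoly_colored {c : (Fin k → J) → ℝ} (hc : ∀ i, ¬ Function.Injective i → c i = 0)
    (g : J → ℝ) :
    (k : ℝ) ^ k * ∑ δ, chaosPoly (colored c δ) g = k ^ Fintype.card J * chaosPoly c g := by
  simp only [chaosPoly, Finset.mul_sum]
  rw [Finset.sum_comm]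
  refine Finset.sum_congr rfl fun i _ => ?_
  by_cases hi : Function.Injective i
  · have h := card_coloring_mul hi
    have h' : ((Finset.univ.filter fun δ : J → Fin k => ∀ l, δ (i l) = l).card : ℝ) * k ^ k =
      k ^ Fintype.card J := by exact_mod_cast h
    rw [← h', ← Finset.mul_sum]
    simp only [colored, ite_mul, zero_mul]
    rw [← Finset.sum_filter, Finset.sum_const, nsmul_eq_mul]
    ring
  · simp [colored, hc i hi]

/-- The polynomial is k^k times the average of its colored parts, so convexity of the even power
applies. -/
lemma chaosPoly_pow_le {c : (Fin k → J) → ℝ} (hk : 0 < k)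
    (hc : ∀ i, ¬ Function.Injective i → c i = 0) (g : J → ℝ) (M : ℕ) :
    chaosPoly c g ^ (2 * M) ≤ ((k : ℝ) ^ k) ^ (2 * M) * ((k : ℝ) ^ Fintype.card J)⁻¹ *
      ∑ δ, chaosPoly (colored c δ) g ^ (2 * M) := by
  have hk' : (0 : ℝ) < k := by exact_mod_cast hk
  set N := (k : ℝ) ^ Fintype.card J with hN
  have hN0 : 0 < N := by positivity
  have h := sum_chaosPoly_colored hc g
  rw [← hN] at h
  have hF : chaosPoly c g = k ^ k * ∑ δ, N⁻¹ * chaosPoly (colored c δ) g := by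
    rw [← Finset.mul_sum, mul_left_comm, h, ← mul_assoc, inv_mul_cancel₀ hN0.ne', one_mul]
  rw [hF, mul_pow, mul_assoc, Finset.mul_sum]
  refine mul_le_mul_of_nonneg_left ?_ (by positivity)
  refine Real.pow_arith_mean_le_arith_mean_pow_of_even Finset.univ (fun _ => N⁻¹) _
    (fun _ _ => by positivity) ?_ (even_two_mul M)
  rw [Finset.sum_const, nsmul_eq_mul, Finset.card_univ, Fintype.card_fun, Fintype.card_fin]
  push_cast
  exact mul_inv_cancel₀ hN0.ne'

-- Compatibility with a coloring is a condition on each leg separately, so it can be transferred to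
-- the two test vectors, where it only lowers their norms.
omit [DecidableEq J] in
lemma colored_hasBlockBounds {c : (Fin k → J) → ℝ} {ρ : ℝ} (hc : HasBlockBounds c ρ)
    (δ : J → Fin k) : HasBlockBounds (colored c δ) ρ where
  sum_sq_le := by
    refine le_trans (Finset.sum_le_sum fun i _ => ?_) hc.sum_sq_le
    unfold colored
    split_ifs
    · exact le_rfl
    · rw [zero_pow two_ne_zero]; exact sq_nonneg _
  bilinear_le A B _ _ _ _ _ _ e u v hu hv := by
    have hle : ∀ {D : Type} [Fintype D] [DecidableEq D] (p : (D → J) → Prop) [DecidablePred p]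
        (w : (D → J) → ℝ), ∑ a, w a ^ 2 ≤ 1 → ∑ a, (if p a then w a else 0) ^ 2 ≤ 1 := by
      intro D _ _ p _ w hw
      refine le_trans (Finset.sum_le_sum fun i _ => ?_) hw
      split_ifs
      · exact le_rfl
      · rw [zero_pow two_ne_zero]; exact sq_nonneg _
    have h := hc.bilinear_le A B e (fun a => if ∀ x, δ (a x) = e (Sum.inl x) then u a else 0)
      (fun b => if ∀ x, δ (b x) = e (Sum.inr x) then v b else 0) (hle _ u hu) (hle _ v hv)
    have hiff : ∀ i : Fin k → J, (∀ l, δ (i l) = l) ↔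
        (∀ x, δ (i (e (Sum.inl x))) = e (Sum.inl x)) ∧
        ∀ x, δ (i (e (Sum.inr x))) = e (Sum.inr x) := fun i => by
      rw [← e.forall_congr_right, Sum.forall]
    have hterm : ∀ i, colored c δ i *
        (u (fun a => i (e (Sum.inl a))) * v (fun b => i (e (Sum.inr b)))) =
        c i * ((if ∀ x, δ (i (e (Sum.inl x))) = e (Sum.inl x) then
          u (fun a => i (e (Sum.inl a))) else 0) *
          (if ∀ x, δ (i (e (Sum.inr x))) = e (Sum.inr x) then
          v (fun b => i (e (Sum.inr b))) else 0)) := fun i => by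
      unfold colored
      by_cases h1 : ∀ x, δ (i (e (Sum.inl x))) = e (Sum.inl x)
      · by_cases h2 : ∀ x, δ (i (e (Sum.inr x))) = e (Sum.inr x)
        · rw [if_pos ((hiff i).2 ⟨h1, h2⟩), if_pos h1, if_pos h2]
        · rw [if_neg (fun h => h2 ((hiff i).1 h).2), if_neg h2, mul_zero, mul_zero, zero_mul]
      · rw [if_neg (fun h => h1 ((hiff i).1 h).1), if_neg h1, zero_mul, zero_mul, mul_zero]
    rw [Finset.sum_congr rfl fun i _ => hterm i]
    exact h

-- Coordinate j is read from the copy numbered δ j, and distinct coordinates stay independent.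
omit [DecidableEq J] in
lemma measurePreserving_coloring {E : Type*} [MeasurableSpace E] (μ : Measure E)
    [IsProbabilityMeasure μ] (δ : J → Fin k) :
    MeasurePreserving (fun (G : Fin k → J → E) j => G (δ j) j)
      (Measure.pi fun _ => Measure.pi fun _ => μ) (Measure.pi fun _ => μ) := by
  have hm : Measurable fun (G : Fin k → J → E) j => G (δ j) j := by fun_prop
  refine ⟨hm, (Measure.pi_eq fun s hs => ?_).symm⟩
  rw [Measure.map_apply hm (MeasurableSet.univ_pi hs)]
  have e : (fun (G : Fin k → J → E) j => G (δ j) j) ⁻¹' Set.univ.pi s =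
      Set.univ.pi fun q => Set.univ.pi fun j => if δ j = q then s j else Set.univ := by
    ext G
    simp only [Set.mem_preimage, Set.mem_univ_pi]
    refine ⟨fun h q j => ?_, fun h j => by simpa using h (δ j) j⟩
    split_ifs with hq
    · exact hq ▸ h j
    · trivial
  rw [e, Measure.pi_pi]
  simp_rw [Measure.pi_pi]
  rw [Finset.prod_comm]
  refine Finset.prod_congr rfl fun j _ => ?_
  rw [Finset.prod_eq_single (δ j)]
  · simp
  · intro q _ hq
    simp [hq.symm]
  · simp

-- On compatible multi-indices, i_l has color l, so the l-th copy is exactly the one read there.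
omit [DecidableEq J] in
lemma contract_colored (c : (Fin k → J) → ℝ) (δ : J → Fin k) (G : Fin k → J → ℝ) :
    contract (colored c δ) G = chaosPoly (colored c δ) fun j => G (δ j) j := by
  refine Finset.sum_congr rfl fun i _ => ?_
  unfold colored
  split_ifs with h
  · simp only [h, smul_eq_mul, mul_comm]
  · simp

omit [DecidableEq J] in
lemma continuous_chaosPoly (c : (Fin k → J) → ℝ) : Continuous (chaosPoly c) := by
  unfold chaosPoly
  fun_prop

/-- The bound of the `2M`-th moment of a Gaussian polynomial of degree `k`. -/
def momentBound (k M : ℕ) (ρ : ℝ) : ℝ :=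
  ((k : ℝ) ^ k) ^ (2 * M) * ((3 * M) ^ M *
    ((64 ^ M) ^ (k - 1) * (1 + ((M : ℝ) ^ M) ^ (k - 1) * (ρ ^ 2) ^ (M - 1))))

theorem HasBlockBounds.lintegral_chaosPoly_pow_le {c : (Fin k → J) → ℝ} {ρ : ℝ}
    (hb : HasBlockBounds c ρ) (hk : 2 ≤ k) (hc : ∀ i, ¬ Function.Injective i → c i = 0) {M : ℕ}
    (hM : 1 ≤ M) :
    ∫⁻ g, ENNReal.ofReal (chaosPoly c g ^ (2 * M)) ∂stdGauss J ≤
      ENNReal.ofReal (momentBound k M ρ) := by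
  have hρ := hb.rho_nonneg hk
  have hδ : ∀ δ : J → Fin k,
      ∫⁻ g, ENNReal.ofReal (chaosPoly (colored c δ) g ^ (2 * M)) ∂stdGauss J ≤
        ENNReal.ofReal ((3 * M) ^ M *
          ((64 ^ M) ^ (k - 1) * (1 + ((M : ℝ) ^ M) ^ (k - 1) * (ρ ^ 2) ^ (M - 1)))) := by
    intro δ
    rw [← (measurePreserving_coloring (gaussianReal 0 1) δ).lintegral_comp
      (f := fun g => ENNReal.ofReal (chaosPoly (colored c δ) g ^ (2 * M))) (ENNReal.continuous_ofReal.comp ((continuous_chaosPoly _).pow _)).measurable]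
    simp_rw [← contract_colored]
    obtain ⟨K, rfl⟩ : ∃ K, k = K + 1 := ⟨k - 1, by omega⟩
    exact (colored_hasBlockBounds hb δ).lintegral_contract_pow_le hρ hM
  have hk' : (0 : ℝ) < k := by exact_mod_cast (by omega : 0 < k)
  set a := ((k : ℝ) ^ k) ^ (2 * M) * ((k : ℝ) ^ Fintype.card J)⁻¹ with ha
  have ha0 : 0 ≤ a := by positivity
  calc _ ≤ ∫⁻ g, ENNReal.ofReal a * ∑ δ, ENNReal.ofReal (chaosPoly (colored c δ) g ^ (2 * M))
        ∂stdGauss J := by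
        refine lintegral_mono fun g => ?_
        simp only
        rw [← ENNReal.ofReal_sum_of_nonneg (fun δ _ => (even_two_mul M).pow_nonneg _),
          ← ENNReal.ofReal_mul ha0]
        exact ENNReal.ofReal_le_ofReal (chaosPoly_pow_le (by omega) hc g M)
    _ = ENNReal.ofReal a * ∑ δ, ∫⁻ g, ENNReal.ofReal (chaosPoly (colored c δ) g ^ (2 * M))
        ∂stdGauss J := by
        rw [lintegral_const_mul' _ _ ENNReal.ofReal_ne_top, lintegral_finsetSum]
        exact fun δ _ => (ENNReal.continuous_ofReal.comp
          ((continuous_chaosPoly _).pow _)).measurable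
    _ ≤ ENNReal.ofReal a * ∑ δ : J → Fin k, _ :=
        mul_le_mul_right (Finset.sum_le_sum fun δ _ => hδ δ) _
    _ = _ := by
        -- The number k^|J| of colorings cancels the averaging factor, so no dimension survives.
        rw [Finset.sum_const, nsmul_eq_mul, Finset.card_univ, Fintype.card_fun, Fintype.card_fin,
          ← ENNReal.ofReal_natCast, ← ENNReal.ofReal_mul (by positivity), ← ENNReal.ofReal_mul ha0,
          momentBound, ha]
        congr 1
        push_cast
        field_simp

end Decoupling

/-! ### From white noise to independent Gaussians -/

section WhiteNoise

variable {X Ω : Type*} [MeasurableSpace X] [MeasurableSpace Ω] {μ : Measure X} {P : Measure Ω}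
  {W : FiniteMeasureSet μ → Ω → ℝ}

lemma IsWhiteNoise.hasGaussianLaw (hW : IsWhiteNoise μ P W) {n : ℕ} (A : Fin n → FiniteMeasureSet μ) :
    HasGaussianLaw (fun ω j => W (A j) ω) P := by
  have h := (hW.gaussian.comp_right A).hasGaussianLaw Finset.univ
  exact h.map_fun (ContinuousLinearMap.pi fun j : Fin n =>
    ContinuousLinearMap.proj (R := ℝ) (φ := fun _ => ℝ) (⟨j, Finset.mem_univ j⟩ : Finset.univ))

lemma IsWhiteNoise.covariance_eq (hW : IsWhiteNoise μ P W) (A B : FiniteMeasureSet μ) :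
    cov[W A, W B; P] = (μ ((A : Set X) ∩ (B : Set X))).toReal := by
  have := hW.gaussian.isProbabilityMeasure
  rw [covariance_eq_sub (hW.gaussian.hasGaussianLaw_eval A).memLp_two
    (hW.gaussian.hasGaussianLaw_eval B).memLp_two, hW.mean_zero, zero_mul, sub_zero,
    ← hW.covariance]
  rfl

lemma IsWhiteNoise.map_eq (hW : IsWhiteNoise μ P W) (A : FiniteMeasureSet μ) :
    P.map (W A) = (gaussianReal 0 1).map (fun t => √(μ A).toReal * t) := by
  have := hW.gaussian.isProbabilityMeasure
  rw [(hW.gaussian.hasGaussianLaw_eval A).map_eq_gaussianReal, hW.mean_zero,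
    gaussianReal_map_const_mul, mul_zero, mul_one,
    ← covariance_self (hW.gaussian.aemeasurable A), hW.covariance_eq, Set.inter_self]
  congr 1
  ext
  simp [Real.sq_sqrt]
  rfl

/-- Disjointness makes the values uncorrelated, and joint Gaussianity then makes them independent.
-/
lemma IsWhiteNoise.map_pi_eq (hW : IsWhiteNoise μ P W) {n : ℕ} (A : Fin n → FiniteMeasureSet μ)
    (hA : ∀ i j, i ≠ j → Disjoint (A i : Set X) (A j : Set X)) :
    P.map (fun ω j => W (A j) ω) =
      (stdGauss (Fin n)).map (fun g j => √(μ (A j)).toReal * g j) := by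
  have := hW.gaussian.isProbabilityMeasure
  have hind : iIndepFun (fun j => W (A j)) P :=
    (hW.hasGaussianLaw A).iIndepFun_of_covariance_eq_zero fun i j hij => by
      rw [hW.covariance_eq, (hA i j hij).inter_eq]
      simp
  rw [(iIndepFun_iff_map_fun_eq_pi_map fun j => hW.gaussian.aemeasurable (A j)).1 hind,
    Measure.pi_map_pi (f := fun j t => √(μ (A j)).toReal * t) (fun j => by fun_prop)]
  congr 1
  ext1 j
  exact hW.map_eq (A j)

/-- The coefficients of an elementary kernel with respect to normalized indicator functions. -/
def ElementaryKernel.coeff {k : ℕ} (φ : ElementaryKernel μ k) (i : Fin k → Fin φ.n) : ℝ :=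
  φ.c i * ∏ l, √(μ (φ.A (i l))).toReal

lemma IsWhiteNoise.lintegral_integral_pow (hW : IsWhiteNoise μ P W) {k : ℕ}
    (φ : ElementaryKernel μ k) (m : ℕ) :
    ∫⁻ ω, ENNReal.ofReal (((k.factorial : ℝ) * φ.integral W ω) ^ m) ∂P =
      ∫⁻ g, ENNReal.ofReal (chaosPoly φ.coeff g ^ m) ∂stdGauss (Fin φ.n) := by
  have hm : Measurable fun y : Fin φ.n → ℝ => ENNReal.ofReal (chaosPoly φ.c y ^ m) :=
    (ENNReal.continuous_ofReal.comp ((continuous_chaosPoly _).pow _)).measurable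
  have h1 : ∀ ω, (k.factorial : ℝ) * φ.integral W ω =
      chaosPoly φ.c (fun j => W (φ.A j) ω) := fun ω => by
    rw [ElementaryKernel.integral, ← mul_assoc, mul_one_div_cancel (by positivity), one_mul]
    rfl
  simp_rw [h1]
  rw [← lintegral_map' (f := fun y : Fin φ.n → ℝ => ENNReal.ofReal (chaosPoly φ.c y ^ m))
    hm.aemeasurable (hW.hasGaussianLaw φ.A).aemeasurable, hW.map_pi_eq φ.A φ.disjoint,
    lintegral_map hm (by fun_prop)]
  refine lintegral_congr fun g => ?_
  congr 2
  refine Finset.sum_congr rfl fun i _ => ?_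
  rw [Finset.prod_mul_distrib, ElementaryKernel.coeff, mul_assoc]

lemma ElementaryKernel.coeff_eq_zero {k : ℕ} (φ : ElementaryKernel μ k) (i : Fin k → Fin φ.n)
    (hi : ¬ Function.Injective i) : φ.coeff i = 0 := by
  rw [ElementaryKernel.coeff, φ.c_diag i hi, zero_mul]

lemma chaosPoly_const_mul {J : Type} [Fintype J] {k : ℕ} (a : ℝ) (c : (Fin k → J) → ℝ)
    (g : J → ℝ) : chaosPoly (fun i => a * c i) g = a * chaosPoly c g := by
  simp only [chaosPoly, Finset.mul_sum, mul_assoc]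

/-- Approximation may double the bounds inherited from f, so the hypothesis concerns half the
coefficients; undoing this costs 2^(2M) = 4^M. -/
lemma IsWhiteNoise.lintegral_integral_pow_le (hW : IsWhiteNoise μ P W) {k : ℕ} (hk : 2 ≤ k)
    (φ : ElementaryKernel μ k) {ρ : ℝ} (hφ : HasBlockBounds (fun i => 2⁻¹ * φ.coeff i) ρ) {M : ℕ}
    (hM : 1 ≤ M) :
    ∫⁻ ω, ENNReal.ofReal (((k.factorial : ℝ) * φ.integral W ω) ^ (2 * M)) ∂P ≤
      ENNReal.ofReal (4 ^ M * momentBound k M ρ) := by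
  have h := hφ.lintegral_chaosPoly_pow_le hk
    (fun i hi => by rw [φ.coeff_eq_zero i hi, mul_zero]) hM
  rw [hW.lintegral_integral_pow, ENNReal.ofReal_mul (by positivity)]
  refine le_trans (le_of_eq ?_) (mul_le_mul_right h _)
  rw [← lintegral_const_mul' _ _ ENNReal.ofReal_ne_top]
  refine lintegral_congr fun g => ?_
  rw [← ENNReal.ofReal_mul (by positivity), chaosPoly_const_mul, mul_pow, pow_mul 2⁻¹,
    ← mul_assoc, ← mul_pow]
  norm_num

end WhiteNoise

/-! ### Step functions and their coefficients -/

section Step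

variable {X : Type*} [MeasurableSpace X] {μ : Measure X} [SigmaFinite μ] {J : Type} [Fintype J]
  {D : Type*} [Fintype D]

/-- The step function with coefficients `w` on the products of the sets `A j`. -/
def stepFun [DecidableEq D] (A : J → FiniteMeasureSet μ) (w : (D → J) → ℝ) (x : D → X) : ℝ :=
  ∑ i, w i * ∏ l, Set.indicator (A (i l) : Set X) (fun _ => (1 : ℝ)) (x l)

omit [Fintype J] [SigmaFinite μ] in
lemma prod_indicator_eq (A : J → FiniteMeasureSet μ) (i : D → J) :
    (fun x : D → X => ∏ l, Set.indicator (A (i l) : Set X) (fun _ => (1 : ℝ)) (x l)) =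
      Set.indicator (Set.univ.pi fun l => (A (i l) : Set X)) (fun _ => 1) := by
  classical
  ext x
  by_cases hx : x ∈ Set.univ.pi fun l => (A (i l) : Set X)
  · rw [Set.indicator_of_mem hx]
    exact Finset.prod_eq_one fun l _ => Set.indicator_of_mem (hx l trivial) _
  · rw [Set.indicator_of_notMem hx]
    simp only [Set.mem_univ_pi, not_forall] at hx
    obtain ⟨l, hl⟩ := hx
    exact Finset.prod_eq_zero (Finset.mem_univ l) (Set.indicator_of_notMem hl _)

omit [Fintype J] [SigmaFinite μ] in
lemma measurableSet_box (A : J → FiniteMeasureSet μ) (i : D → J) :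
    MeasurableSet (Set.univ.pi fun l => (A (i l) : Set X)) :=
  MeasurableSet.univ_pi fun l => (A (i l)).2.1

omit [Fintype J] in
lemma measure_box (A : J → FiniteMeasureSet μ) (i : D → J) :
    (Measure.pi fun _ : D => μ) (Set.univ.pi fun l => (A (i l) : Set X)) =
      ∏ l, μ (A (i l)) := Measure.pi_pi _ _

omit [Fintype J] in
lemma memLp_prod_indicator (A : J → FiniteMeasureSet μ) (i : D → J) :
    MemLp (fun x : D → X => ∏ l, Set.indicator (A (i l) : Set X) (fun _ => (1 : ℝ)) (x l)) 2
      (Measure.pi fun _ : D => μ) := by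
  rw [prod_indicator_eq]
  refine memLp_indicator_const 2 (measurableSet_box A i) 1 (Or.inr ?_)
  rw [measure_box]
  exact (ENNReal.prod_lt_top fun l _ => (A (i l)).2.2).ne

variable [DecidableEq D]

omit [SigmaFinite μ] in
lemma measurable_stepFun (A : J → FiniteMeasureSet μ) (w : (D → J) → ℝ) :
    Measurable (stepFun A w : (D → X) → ℝ) := by
  unfold stepFun
  refine Finset.measurable_sum _ fun i _ => Measurable.const_mul ?_ _
  rw [prod_indicator_eq]
  exact measurable_const.indicator (measurableSet_box A i)

lemma memLp_stepFun (A : J → FiniteMeasureSet μ) (w : (D → J) → ℝ) :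
    MemLp (stepFun A w : (D → X) → ℝ) 2 (Measure.pi fun _ : D => μ) := by
  unfold stepFun
  exact memLp_finsetSum _ fun i _ => (memLp_prod_indicator A i).const_mul (w i)

/-- Boxes with different multi-indices are disjoint, so only diagonal terms contribute. -/
lemma integral_stepFun_mul (A : J → FiniteMeasureSet μ)
    (hA : ∀ i j, i ≠ j → Disjoint (A i : Set X) (A j : Set X)) (w w' : (D → J) → ℝ) :
    ∫ x, stepFun A w x * stepFun A w' x ∂(Measure.pi fun _ : D => μ) =
      ∑ i, w i * w' i * ∏ l, (μ (A (i l))).toReal := by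
  classical
  have hint : ∀ i i' : D → J, Integrable (fun x : D → X =>
      (∏ l, Set.indicator (A (i l) : Set X) (fun _ => (1 : ℝ)) (x l)) *
      (∏ l, Set.indicator (A (i' l) : Set X) (fun _ => (1 : ℝ)) (x l)))
      (Measure.pi fun _ : D => μ) := fun i i' =>
    (memLp_prod_indicator A i).integrable_mul (memLp_prod_indicator A i')
  have hval : ∀ i i' : D → J, ∫ x : D → X,
      (∏ l, Set.indicator (A (i l) : Set X) (fun _ => (1 : ℝ)) (x l)) *
      (∏ l, Set.indicator (A (i' l) : Set X) (fun _ => (1 : ℝ)) (x l))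
      ∂(Measure.pi fun _ : D => μ) = if i = i' then ∏ l, (μ (A (i l))).toReal else 0 := by
    intro i i'
    split_ifs with h
    · subst h
      have e : ∀ x : D → X, (∏ l, Set.indicator (A (i l) : Set X) (fun _ => (1 : ℝ)) (x l)) *
          (∏ l, Set.indicator (A (i l) : Set X) (fun _ => (1 : ℝ)) (x l)) =
          Set.indicator (Set.univ.pi fun l => (A (i l) : Set X)) (fun _ => 1) x := fun x => by
        rw [← prod_indicator_eq, ← Finset.prod_mul_distrib]
        refine Finset.prod_congr rfl fun l _ => ?_
        by_cases hx : x l ∈ (A (i l) : Set X) <;> simp [hx]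
      simp_rw [e]
      rw [integral_indicator (measurableSet_box A i), setIntegral_const, smul_eq_mul, mul_one,
        measureReal_def, measure_box, ENNReal.toReal_prod]
    · obtain ⟨l, hl⟩ := Function.ne_iff.1 h
      rw [← integral_zero (D → X) ℝ (μ := Measure.pi fun _ : D => μ)]
      refine integral_congr_ae (Filter.Eventually.of_forall fun x => ?_)
      simp only
      by_cases hx : x l ∈ (A (i l) : Set X)
      · have hx' : x l ∉ (A (i' l) : Set X) := Set.disjoint_left.1 (hA _ _ hl) hx
        rw [Finset.prod_eq_zero (f := fun l => Set.indicator (A (i' l) : Set X)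
          (fun _ => (1 : ℝ)) (x l)) (Finset.mem_univ l) (Set.indicator_of_notMem hx' _), mul_zero]
      · rw [Finset.prod_eq_zero (f := fun l => Set.indicator (A (i l) : Set X)
          (fun _ => (1 : ℝ)) (x l)) (Finset.mem_univ l) (Set.indicator_of_notMem hx _), zero_mul]
  have e : ∀ x : D → X, stepFun A w x * stepFun A w' x = ∑ i, ∑ i', w i * w' i' *
      ((∏ l, Set.indicator (A (i l) : Set X) (fun _ => (1 : ℝ)) (x l)) *
      (∏ l, Set.indicator (A (i' l) : Set X) (fun _ => (1 : ℝ)) (x l))) := fun x => by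
    simp only [stepFun, Finset.sum_mul_sum]
    exact Finset.sum_congr rfl fun i _ => Finset.sum_congr rfl fun i' _ => by ring
  simp_rw [e]
  rw [integral_finsetSum _ fun i _ => integrable_finsetSum _ fun i' _ => (hint i i').const_mul _]
  refine Finset.sum_congr rfl fun i _ => ?_
  rw [integral_finsetSum _ fun i' _ => (hint i i').const_mul _]
  simp_rw [integral_const_mul, hval]
  simp

omit [Fintype J] [SigmaFinite μ] [DecidableEq D] in
lemma prod_sqrt_mul_self (A : J → FiniteMeasureSet μ) (i : D → J) :
    (∏ l, √(μ (A (i l))).toReal) * ∏ l, √(μ (A (i l))).toReal = ∏ l, (μ (A (i l))).toReal := by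
  rw [← Finset.prod_mul_distrib]
  exact Finset.prod_congr rfl fun l _ => Real.mul_self_sqrt ENNReal.toReal_nonneg

/-- The step function whose coefficients with respect to normalized indicators are `u`. -/
def normalizedStep (A : J → FiniteMeasureSet μ) (u : (D → J) → ℝ) : (D → X) → ℝ :=
  stepFun A fun i => u i / ∏ l, √(μ (A (i l))).toReal

/-- Equality can fail: on null boxes the normalization divides by 0 and the coefficient is lost. -/
lemma integral_normalizedStep_sq_le (A : J → FiniteMeasureSet μ)
    (hA : ∀ i j, i ≠ j → Disjoint (A i : Set X) (A j : Set X)) {u : (D → J) → ℝ}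
    (hu : ∑ i, u i ^ 2 ≤ 1) :
    ∫ x, normalizedStep A u x ^ 2 ∂(Measure.pi fun _ : D => μ) ≤ 1 := by
  simp_rw [pow_two, normalizedStep]
  rw [integral_stepFun_mul A hA]
  refine le_trans (Finset.sum_le_sum fun i _ => ?_) hu
  rw [← prod_sqrt_mul_self]
  set s := ∏ l, √(μ (A (i l))).toReal
  by_cases hs : s = 0
  · rw [hs]; simpa using sq_nonneg (u i)
  · exact le_of_eq (by field_simp)

/-- Here equality survives null boxes, since both sides vanish on them. -/
lemma integral_stepFun_mul_normalizedStep (A : J → FiniteMeasureSet μ)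
    (hA : ∀ i j, i ≠ j → Disjoint (A i : Set X) (A j : Set X)) (c u : (D → J) → ℝ) :
    ∫ x, stepFun A c x * normalizedStep A u x ∂(Measure.pi fun _ : D => μ) =
      ∑ i, (c i * ∏ l, √(μ (A (i l))).toReal) * u i := by
  rw [normalizedStep, integral_stepFun_mul A hA]
  refine Finset.sum_congr rfl fun i _ => ?_
  rw [← prod_sqrt_mul_self]
  set s := ∏ l, √(μ (A (i l))).toReal
  by_cases hs : s = 0
  · rw [hs]; simp
  · field_simp

lemma lintegral_ofReal_normalizedStep_sq_le (A : J → FiniteMeasureSet μ)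
    (hA : ∀ i j, i ≠ j → Disjoint (A i : Set X) (A j : Set X)) {u : (D → J) → ℝ}
    (hu : ∑ i, u i ^ 2 ≤ 1) :
    ∫⁻ x, ENNReal.ofReal (normalizedStep A u x ^ 2) ∂(Measure.pi fun _ : D => μ) ≤ 1 := by
  rw [← ofReal_integral_eq_lintegral_ofReal (f := fun x => normalizedStep A u x ^ 2)
    (memLp_stepFun A _).integrable_sq
    (Filter.Eventually.of_forall fun x => sq_nonneg _)]
  exact ENNReal.ofReal_le_one.2 (integral_normalizedStep_sq_le A hA hu)

omit [SigmaFinite μ] in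
lemma normalizedStep_mul {K B C : Type} [Fintype K] [DecidableEq K] [Fintype B] [DecidableEq B]
    [Fintype C] [DecidableEq C] (e : B ⊕ C ≃ K) (A : J → FiniteMeasureSet μ)
    (u : (B → J) → ℝ) (v : (C → J) → ℝ) (x : K → X) :
    normalizedStep A u (fun b => x (e (Sum.inl b))) *
      normalizedStep A v (fun c => x (e (Sum.inr c))) =
      normalizedStep A (fun i => u (fun b => i (e (Sum.inl b))) * v (fun c => i (e (Sum.inr c))))
        x := by
  simp only [normalizedStep, stepFun]
  rw [Finset.sum_mul_sum, ← Fintype.sum_prod_type', ← ((Equiv.sumArrowEquivProdArrow B C J).symm.trans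
    (e.arrowCongr (Equiv.refl J))).sum_comp]
  refine Finset.sum_congr rfl fun p _ => ?_
  rw [← e.prod_comp, ← e.prod_comp, Fintype.prod_sum_type, Fintype.prod_sum_type]
  simp [Equiv.arrowCongr, Equiv.sumArrowEquivProdArrow]
  ring

end Step

/-! ### Test functions for V₁ and V₂ -/

section Partition

variable {X : Type*} [MeasurableSpace X] {μ : Measure X} [SigmaFinite μ]

lemma lintegral_comp_bijective {D D' : Type*} [Fintype D] [Fintype D'] {τ : D → D'}
    (hτ : Function.Bijective τ) {F : (D → X) → ENNReal} (hF : Measurable F) :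
    ∫⁻ x : D' → X, F (fun a => x (τ a)) ∂(Measure.pi fun _ => μ) =
      ∫⁻ x, F x ∂(Measure.pi fun _ => μ) :=
  (measurePreserving_piCongrLeft (fun _ : D' => μ) (Equiv.ofBijective τ hτ)).symm.lintegral_comp hF

variable {K : Type} [Fintype K] [DecidableEq K] {f : (K → X) → ℝ}

/-- The partition is the one-block partition; h is transported to the subtype indexing its block. -/
lemma integral_le_V_one [Nonempty K] {h : (K → X) → ℝ} (hm : Measurable h)
    (h1 : ∫⁻ x, ENNReal.ofReal (h x ^ 2) ∂(Measure.pi fun _ => μ) ≤ 1) :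
    ((∫ x, f x * h x ∂(Measure.pi fun _ : K => μ) : ℝ) : EReal) ≤ V μ 1 f := by
  have hne : (Finset.univ : Finset K) ≠ ⊥ := Finset.univ_nonempty.ne_empty
  set P : Finpartition (Finset.univ : Finset K) := Finpartition.indiscrete hne with hP
  have hmem : ∀ D : {D : Finset K // D ∈ P.parts}, D.1 = Finset.univ := fun D =>
    Finset.mem_singleton.1 D.2
  set D₀ : {D : Finset K // D ∈ P.parts} := ⟨Finset.univ,
    Finset.mem_singleton_self _⟩ with hD₀
  set g : (D : {D : Finset K // D ∈ P.parts}) → ({j : K // j ∈ D.1} → X) → ℝ :=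
    fun D x => h fun j => x ⟨j, by rw [hmem D]; exact Finset.mem_univ j⟩ with hg
  have hgP : g ∈ blockFunctions μ P := by
    intro D
    have hb : Function.Bijective fun j : K =>
        (⟨j, by rw [hmem D]; exact Finset.mem_univ j⟩ : {j : K // j ∈ D.1}) :=
      ⟨fun a b hab => congrArg Subtype.val hab, fun b => ⟨b.1, rfl⟩⟩
    refine ⟨by fun_prop, ?_⟩
    exact (lintegral_comp_bijective (μ := μ) hb
      (F := fun x => ENNReal.ofReal (h x ^ 2)) (by fun_prop)).trans_le h1
  have hprod : ∀ x : K → X, ∏ D, g D (fun j => x j.1) = h x := fun x => by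
    rw [Fintype.prod_eq_single D₀ fun D hD => absurd (Subtype.ext (hmem D)) hD]
  refine le_trans ?_ (le_iSup₂_of_le (f := fun (P : Finpartition (Finset.univ : Finset K))
    (_ : P.parts.card = 1) => VP μ f P) P (by simp [hP]) le_rfl)
  refine le_trans (le_of_eq ?_) (le_iSup₂_of_le g hgP le_rfl)
  simp_rw [hprod]

/-- The two blocks are the images of B and C under e; nonemptiness keeps them distinct and
admissible. -/
lemma integral_le_V_two {B C : Type} [Fintype B] [Fintype C] [Nonempty B] [Nonempty C]
    (e : B ⊕ C ≃ K) {h₁ : (B → X) → ℝ} {h₂ : (C → X) → ℝ} (hm₁ : Measurable h₁)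
    (hm₂ : Measurable h₂) (hn₁ : ∫⁻ x, ENNReal.ofReal (h₁ x ^ 2) ∂(Measure.pi fun _ => μ) ≤ 1)
    (hn₂ : ∫⁻ x, ENNReal.ofReal (h₂ x ^ 2) ∂(Measure.pi fun _ => μ) ≤ 1) :
    ((∫ x, f x * (h₁ (fun b => x (e (Sum.inl b))) * h₂ (fun c => x (e (Sum.inr c))))
      ∂(Measure.pi fun _ : K => μ) : ℝ) : EReal) ≤ V μ 2 f := by
  set S : Finset K := Finset.univ.image fun b => e (Sum.inl b) with hS
  set S' : Finset K := Finset.univ.image fun c => e (Sum.inr c) with hS'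
  have hSS' : ∀ j, j ∈ S → j ∉ S' := by
    intro j hj hj'
    obtain ⟨b, -, rfl⟩ := Finset.mem_image.1 hj
    obtain ⟨c, -, hc⟩ := Finset.mem_image.1 hj'
    simpa using e.injective hc
  have hSu : ∀ j, j ∈ S ∨ j ∈ S' := by
    intro j
    rcases h : e.symm j with b | c
    · exact Or.inl (Finset.mem_image.2 ⟨b, Finset.mem_univ _, by rw [← h]; simp⟩)
    · exact Or.inr (Finset.mem_image.2 ⟨c, Finset.mem_univ _, by rw [← h]; simp⟩)
  have hSne : S.Nonempty := Finset.univ_nonempty.image _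
  have hSne' : S'.Nonempty := Finset.univ_nonempty.image _
  have hne : S ≠ S' := by
    obtain ⟨j, hj⟩ := hSne
    exact fun h => hSS' j hj (h ▸ hj)
  set P : Finpartition (Finset.univ : Finset K) := Finpartition.ofExistsUnique {S, S'}
    (fun p _ => Finset.subset_univ p) (fun j _ => by
      rcases hSu j with hj | hj
      · refine ⟨S, ⟨by simp, hj⟩, fun T hT => ?_⟩
        rcases Finset.mem_insert.1 hT.1 with h | h
        · exact h
        · rw [Finset.mem_singleton.1 h] at hT
          exact absurd hT.2 (hSS' j hj)
      · refine ⟨S', ⟨by simp, hj⟩, fun T hT => ?_⟩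
        rcases Finset.mem_insert.1 hT.1 with h | h
        · rw [h] at hT
          exact absurd hj (hSS' j hT.2)
        · exact Finset.mem_singleton.1 h)
    (by simp [hSne.ne_empty.symm, hSne'.ne_empty.symm]) with hP
  have hparts : P.parts = {S, S'} := rfl
  have hmem : ∀ D : {D : Finset K // D ∈ P.parts}, D.1 ≠ S → D.1 = S' := fun D hD => by
    rcases Finset.mem_insert.1 D.2 with h | h
    · exact absurd h hD
    · exact Finset.mem_singleton.1 h
  have hmS : ∀ b, e (Sum.inl b) ∈ S := fun b => Finset.mem_image_of_mem _ (Finset.mem_univ b)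
  have hmS' : ∀ c, e (Sum.inr c) ∈ S' := fun c =>
    Finset.mem_image_of_mem (fun c => e (Sum.inr c)) (Finset.mem_univ c)
  set g : (D : {D : Finset K // D ∈ P.parts}) → ({j : K // j ∈ D.1} → X) → ℝ :=
    fun D => if h : D.1 = S then fun x => h₁ fun b => x ⟨e (Sum.inl b), by rw [h]; exact hmS b⟩
      else fun x => h₂ fun c => x ⟨e (Sum.inr c), by rw [hmem D h]; exact hmS' c⟩ with hg
  have hgP : g ∈ blockFunctions μ P := by
    intro D
    by_cases h : D.1 = S
    · have hb : Function.Bijective fun b : B =>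
          (⟨e (Sum.inl b), by rw [h]; exact hmS b⟩ : {j : K // j ∈ D.1}) := by
        refine ⟨fun a b hab => Sum.inl_injective (e.injective (congrArg Subtype.val hab)), ?_⟩
        rintro ⟨j, hj⟩
        rw [h] at hj
        obtain ⟨b, -, rfl⟩ := Finset.mem_image.1 hj
        exact ⟨b, rfl⟩
      simp only [hg, dif_pos h]
      refine ⟨by fun_prop, ?_⟩
      exact (lintegral_comp_bijective (μ := μ) hb
        (F := fun x => ENNReal.ofReal (h₁ x ^ 2)) (by fun_prop)).trans_le hn₁
    · have hb : Function.Bijective fun c : C =>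
          (⟨e (Sum.inr c), by rw [hmem D h]; exact hmS' c⟩ : {j : K // j ∈ D.1}) := by
        refine ⟨fun a b hab => Sum.inr_injective (e.injective (congrArg Subtype.val hab)), ?_⟩
        rintro ⟨j, hj⟩
        rw [hmem D h] at hj
        obtain ⟨c, -, rfl⟩ := Finset.mem_image.1 hj
        exact ⟨c, rfl⟩
      simp only [hg, dif_neg h]
      refine ⟨by fun_prop, ?_⟩
      exact (lintegral_comp_bijective (μ := μ) hb
        (F := fun x => ENNReal.ofReal (h₂ x ^ 2)) (by fun_prop)).trans_le hn₂
  set D₁ : {D : Finset K // D ∈ P.parts} := ⟨S, by simp [hparts]⟩ with hD₁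
  set D₂ : {D : Finset K // D ∈ P.parts} := ⟨S', by simp [hparts]⟩ with hD₂
  have hprod : ∀ x : K → X, ∏ D, g D (fun j => x j.1) =
      h₁ (fun b => x (e (Sum.inl b))) * h₂ (fun c => x (e (Sum.inr c))) := fun x => by
    rw [Fintype.prod_eq_mul D₁ D₂ (fun h => hne (congrArg Subtype.val h))]
    · simp only [hg]
      rw [dif_pos rfl, dif_neg hne.symm]
    · rintro D ⟨h1, h2⟩
      by_cases h : D.1 = S
      · exact absurd (Subtype.ext h) h1
      · exact absurd (Subtype.ext (hmem D h)) h2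
  refine le_trans ?_ (le_iSup₂_of_le (f := fun (P : Finpartition (Finset.univ : Finset K))
    (_ : P.parts.card = 2) => VP μ f P) P (by rw [hparts, Finset.card_pair hne]) le_rfl)
  refine le_trans (le_of_eq ?_) (le_iSup₂_of_le g hgP le_rfl)
  simp_rw [hprod]

end Partition

/-! ### Passing the bounds from f to its approximations -/

section Discretization

variable {X : Type*} [MeasurableSpace X] {μ : Measure X} [SigmaFinite μ]

/-- Cauchy–Schwarz in the form uh ≤ u²/(2ε) + εh²/2; the case ε = 0 is separate. -/
lemma integral_mul_le_of_eLpNorm_le {Y : Type*} [MeasurableSpace Y] {ν : Measure Y} {u h : Y → ℝ}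
    {ε : ℝ} (hε : 0 ≤ ε) (hu : MemLp u 2 ν) (hh : MemLp h 2 ν)
    (huε : eLpNorm u 2 ν ≤ ENNReal.ofReal ε) (hh1 : ∫ y, h y ^ 2 ∂ν ≤ 1) :
    ∫ y, u y * h y ∂ν ≤ ε := by
  have hu2 : ∫ y, u y ^ 2 ∂ν ≤ ε ^ 2 := by
    rw [hu.eLpNorm_eq_integral_rpow_norm (by norm_num) (by norm_num)] at huε
    have h1 := (ENNReal.ofReal_le_ofReal_iff hε).1 huε
    simp only [ENNReal.toReal_ofNat, Real.rpow_two, Real.norm_eq_abs, sq_abs] at h1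
    have h0 : 0 ≤ ∫ y, u y ^ 2 ∂ν := integral_nonneg fun y => sq_nonneg _
    have h2 := pow_le_pow_left₀ (by positivity) h1 2
    rwa [← Real.rpow_natCast, ← Real.rpow_mul h0, Nat.cast_ofNat, inv_mul_cancel₀ two_ne_zero,
      Real.rpow_one] at h2
  rcases hε.eq_or_lt with h0 | hε'
  · have hz : u =ᵐ[ν] 0 := by
      rw [← h0, ENNReal.ofReal_zero, nonpos_iff_eq_zero] at huε
      exact (eLpNorm_eq_zero_iff hu.1 two_ne_zero).1 huε
    have : ∫ y, u y * h y ∂ν = ∫ _, (0 : ℝ) ∂ν :=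
      integral_congr_ae (hz.mono fun y hy => by simp [hy])
    rw [this, integral_zero]
    exact hε
  have hle : ∫ y, u y * h y ∂ν ≤ ∫ y, (u y ^ 2 / (2 * ε) + h y ^ 2 * (ε / 2)) ∂ν := by
    refine integral_mono (hu.integrable_mul hh)
      ((hu.integrable_sq.div_const _).add (hh.integrable_sq.mul_const _)) fun y => ?_
    have : u y ^ 2 / (2 * ε) + h y ^ 2 * (ε / 2) - u y * h y = (u y - ε * h y) ^ 2 / (2 * ε) := by
      field_simp
      ring
    have h2 : 0 ≤ (u y - ε * h y) ^ 2 / (2 * ε) := by positivity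
    simp only
    linarith
  rw [integral_add (hu.integrable_sq.div_const _) (hh.integrable_sq.mul_const _), integral_div,
    integral_mul_const] at hle
  have h3 : (∫ y, u y ^ 2 ∂ν) / (2 * ε) ≤ ε / 2 := by
    rw [div_le_iff₀ (by positivity)]
    nlinarith
  nlinarith

omit [SigmaFinite μ] in
lemma integral_le_of_V_le {k s : ℕ} {f h : (Fin k → X) → ℝ} {r : ℝ}
    (hV : V μ s f ≤ (r : EReal))
    (hh : ((∫ x, f x * h x ∂(Measure.pi fun _ => μ) : ℝ) : EReal) ≤ V μ s f) :
    ∫ x, f x * h x ∂(Measure.pi fun _ => μ) ≤ r :=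
  EReal.coe_le_coe_iff.1 (hh.trans hV)

/-- A good approximation of `f` by an elementary kernel inherits the bounds on `V₁` and `V₂`. -/
theorem ElementaryKernel.hasBlockBounds {k : ℕ} (hk : 2 ≤ k) (φ : ElementaryKernel μ k)
    {f : (Fin k → X) → ℝ} (hf : MemLp f 2 (Measure.pi fun _ => μ)) {R ε : ℝ} (hε0 : 0 ≤ ε)
    (hε1 : ε ≤ 1) (hεR : ε ≤ R) (hV1 : V μ 1 f ≤ ((1 : ℝ) : EReal)) (hV2 : V μ 2 f ≤ (R : EReal))
    (hφ : eLpNorm (fun x => φ.toFun x - f x) 2 (Measure.pi fun _ => μ) ≤ ENNReal.ofReal ε) :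
    HasBlockBounds (fun i => 2⁻¹ * φ.coeff i) R := by
  have : Nonempty (Fin k) := ⟨⟨0, by omega⟩⟩
  have hφL : MemLp φ.toFun 2 (Measure.pi fun _ => μ) := memLp_stepFun φ.A φ.c
  have hdL : MemLp (fun x => φ.toFun x - f x) 2 (Measure.pi fun _ => μ) := hφL.sub hf
  -- The pairing of the coefficients with u is the integral of the kernel against a normalized step
  -- function; replacing the kernel by f costs at most ε.
  have key : ∀ (u : (Fin k → Fin φ.n) → ℝ) (s : ℕ) (r : ℝ), ∑ i, u i ^ 2 ≤ 1 →
      V μ s f ≤ (r : EReal) →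
      ((∫ x, f x * normalizedStep φ.A u x ∂(Measure.pi fun _ => μ) : ℝ) : EReal) ≤ V μ s f →
      ∑ i, φ.coeff i * u i ≤ r + ε := by
    intro u s r hu hV hs
    have hgL : MemLp (normalizedStep φ.A u) 2 (Measure.pi fun _ : Fin k => μ) :=
      memLp_stepFun φ.A _
    have h1 := integral_le_of_V_le hV hs
    have h2 := integral_mul_le_of_eLpNorm_le hε0 hdL hgL hφ
      (integral_normalizedStep_sq_le φ.A φ.disjoint hu)
    have h3 : ∑ i, φ.coeff i * u i =
        ∫ x, φ.toFun x * normalizedStep φ.A u x ∂(Measure.pi fun _ => μ) :=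
      (integral_stepFun_mul_normalizedStep φ.A φ.disjoint φ.c u).symm
    have h4 : ∫ x, φ.toFun x * normalizedStep φ.A u x ∂(Measure.pi fun _ => μ) =
        ∫ x, f x * normalizedStep φ.A u x ∂(Measure.pi fun _ => μ) +
        ∫ x, (φ.toFun x - f x) * normalizedStep φ.A u x ∂(Measure.pi fun _ => μ) := by
      refine Eq.trans ?_ (integral_add (hf.integrable_mul hgL) (hdL.integrable_mul hgL))
      refine integral_congr_ae (Filter.Eventually.of_forall fun x => ?_)
      simp only
      ring
    linarith
  constructor
  · have hone : ∀ u : (Fin k → Fin φ.n) → ℝ, ∑ i, u i ^ 2 ≤ 1 → ∑ i, φ.coeff i * u i ≤ 2 := by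
      intro u hu
      have := key u 1 1 hu hV1 (integral_le_V_one (measurable_stepFun _ _)
        (lintegral_ofReal_normalizedStep_sq_le φ.A φ.disjoint hu))
      linarith
    set a := √(∑ i, φ.coeff i ^ 2) with ha
    have ha2 : a ^ 2 = ∑ i, φ.coeff i ^ 2 := Real.sq_sqrt (by positivity)
    -- Testing against the normalized coefficients themselves recovers their norm, so it is at most
    -- 1 + ε ≤ 2.
    have h1 := hone (fun i => φ.coeff i / a) (by
      simp_rw [div_pow]; rw [← Finset.sum_div, ← ha2]; exact div_self_le_one _)
    have h2 : ∑ i, φ.coeff i * (φ.coeff i / a) = a := by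
      simp_rw [← mul_div_assoc, ← pow_two]
      rw [← Finset.sum_div, ← ha2, pow_two, mul_self_div_self]
    rw [h2] at h1
    simp_rw [mul_pow]
    rw [← Finset.mul_sum, ← ha2]
    have ha0 : 0 ≤ a := Real.sqrt_nonneg _
    nlinarith
  · intro B C _ _ _ _ _ _ e u v hu hv
    have huv : ∑ i : Fin k → Fin φ.n,
        (u (fun b => i (e (Sum.inl b))) * v (fun c => i (e (Sum.inr c)))) ^ 2 ≤ 1 := by
      have : ∑ i : Fin k → Fin φ.n,
          (u (fun b => i (e (Sum.inl b))) * v (fun c => i (e (Sum.inr c)))) ^ 2 =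
          (∑ b, u b ^ 2) * ∑ c, v c ^ 2 := by
        rw [Finset.sum_mul_sum, ← Fintype.sum_prod_type',
          ← ((Equiv.sumArrowEquivProdArrow B C (Fin φ.n)).symm.trans
            (e.arrowCongr (Equiv.refl (Fin φ.n)))).sum_comp]
        refine Finset.sum_congr rfl fun p _ => ?_
        simp [Equiv.arrowCongr, Equiv.sumArrowEquivProdArrow, mul_pow]
      rw [this]
      exact mul_le_one₀ hu (by positivity) hv
    have h := key _ 2 R huv hV2 (by
      have := integral_le_V_two (f := f) e (measurable_stepFun φ.A _) (measurable_stepFun φ.A _)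
        (lintegral_ofReal_normalizedStep_sq_le φ.A φ.disjoint hu)
        (lintegral_ofReal_normalizedStep_sq_le φ.A φ.disjoint hv)
      refine le_trans (le_of_eq ?_) this
      congr 1
      refine integral_congr_ae (Filter.Eventually.of_forall fun x => ?_)
      simp only
      rw [← normalizedStep_mul e φ.A u v x]
      rfl)
    simp_rw [mul_assoc]
    rw [← Finset.mul_sum]
    linarith

end Discretization

/-! ### Passage to the limit and the final constant -/

section Limit

variable {X Ω : Type*} [MeasurableSpace X] [MeasurableSpace Ω] {μ : Measure X} {P : Measure Ω}
  {W : FiniteMeasureSet μ → Ω → ℝ}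

/-- L² convergence gives an almost everywhere convergent subsequence, to which Fatou's lemma
applies. -/
lemma lintegral_pow_le_of_tendsto {Y : ℕ → Ω → ℝ} {Z : Ω → ℝ} (m : ℕ) (a : ℝ) {B : ENNReal}
    (hY : ∀ n, AEStronglyMeasurable (Y n) P) (hZ : AEStronglyMeasurable Z P)
    (hlim : Filter.Tendsto (fun n => eLpNorm (fun ω => Y n ω - Z ω) 2 P) Filter.atTop (nhds 0))
    (hB : ∀ᶠ n in Filter.atTop, ∫⁻ ω, ENNReal.ofReal ((a * Y n ω) ^ m) ∂P ≤ B) :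
    ∫⁻ ω, ENNReal.ofReal ((a * Z ω) ^ m) ∂P ≤ B := by
  obtain ⟨ns, hns, hae⟩ :=
    (tendstoInMeasure_of_tendsto_eLpNorm two_ne_zero hY hZ hlim).exists_seq_tendsto_ae
  have hcont : Continuous fun t : ℝ => ENNReal.ofReal ((a * t) ^ m) :=
    ENNReal.continuous_ofReal.comp (by fun_prop)
  calc ∫⁻ ω, ENNReal.ofReal ((a * Z ω) ^ m) ∂P
      ≤ ∫⁻ ω, Filter.liminf (fun i => ENNReal.ofReal ((a * Y (ns i) ω) ^ m)) Filter.atTop ∂P := by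
        refine lintegral_mono_ae (hae.mono fun ω hω => ?_)
        exact (((hcont.tendsto _).comp hω).liminf_eq).ge
    _ ≤ Filter.liminf (fun i => ∫⁻ ω, ENNReal.ofReal ((a * Y (ns i) ω) ^ m) ∂P) Filter.atTop :=
        lintegral_liminf_le' fun i =>
          hcont.measurable.comp_aemeasurable (hY (ns i)).aemeasurable
    _ ≤ B := by
        refine Filter.liminf_le_of_le (by isBoundedDefault) fun b hb => ?_
        obtain ⟨i, h1, h2⟩ := (hb.and (hns.tendsto_atTop.eventually hB)).exists
        exact h1.trans h2

lemma IsWhiteNoise.aestronglyMeasurable_integral (hW : IsWhiteNoise μ P W) {k : ℕ}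
    (φ : ElementaryKernel μ k) : AEStronglyMeasurable (φ.integral W) P := by
  unfold ElementaryKernel.integral
  refine AEMeasurable.aestronglyMeasurable (AEMeasurable.const_mul ?_ _)
  refine Finset.aemeasurable_fun_sum _ fun i _ => AEMeasurable.const_mul ?_ _
  exact Finset.aemeasurable_fun_prod _ fun l _ => hW.gaussian.aemeasurable _

end Limit

lemma momentBound_le {k M : ℕ} (hk : 2 ≤ k) (hM : 1 ≤ M) {R : ℝ} (hR0 : 0 < R)
    (hRM : (M : ℝ) ^ (-((k : ℝ) - 1) / 2) ≤ R) :
    4 ^ M * momentBound k M R ≤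
      (4 * (k ^ k) ^ 2 * 3 * 64 ^ (k - 1) * 2 ^ k : ℝ) ^ M * (M : ℝ) ^ (k * M) * R ^ (2 * M) := by
  have hM' : (1 : ℝ) ≤ M := by exact_mod_cast hM
  have hM0 : (0 : ℝ) < M := by linarith
  have h1 : 1 ≤ (M : ℝ) ^ (k - 1) * R ^ 2 := by
    have h2 := pow_le_pow_left₀ (by positivity) hRM 2
    rw [← Real.rpow_natCast, ← Real.rpow_mul hM0.le,
      show -((k : ℝ) - 1) / 2 * ((2 : ℕ) : ℝ) = -((k - 1 : ℕ) : ℝ) by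
        rw [Nat.cast_sub (by omega)]; push_cast; ring,
      Real.rpow_neg hM0.le, Real.rpow_natCast, inv_le_iff_one_le_mul₀ (by positivity)] at h2
    linarith
  have hpow : ∀ n : ℕ, (M : ℝ) ^ n ≤ (2 ^ n) ^ M := fun n => by
    rw [← pow_mul, mul_comm, pow_mul]
    refine pow_le_pow_left₀ hM0.le ?_ n
    exact_mod_cast Nat.lt_two_pow_self.le
  set T := ((M : ℝ) ^ M) ^ (k - 1) * R ^ (2 * M) with hT
  have h3 : 1 ≤ T := by
    have := one_le_pow₀ h1 (n := M)
    rwa [mul_pow, ← pow_mul, mul_comm (k - 1), pow_mul, ← pow_mul R] at this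
  have h4 : ((M : ℝ) ^ M) ^ (k - 1) * (R ^ 2) ^ (M - 1) ≤ (2 ^ (k - 1)) ^ M * T := by
    -- The exponent M - 1 lacks one factor R², which is supplied by 1 ≤ M^(k-1) R²; the extra
    -- M^(k-1) is at most (2^(k-1))^M.
    have h5 : (R ^ 2) ^ (M - 1) ≤ (M : ℝ) ^ (k - 1) * R ^ (2 * M) := by
      obtain ⟨N, rfl⟩ : ∃ N, M = N + 1 := ⟨M - 1, by omega⟩
      rw [Nat.add_sub_cancel, pow_mul R, pow_succ' (R ^ 2), ← mul_assoc]
      exact le_mul_of_one_le_left (by positivity) h1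
    calc _ ≤ ((M : ℝ) ^ M) ^ (k - 1) * ((M : ℝ) ^ (k - 1) * R ^ (2 * M)) := by gcongr
      _ = (M : ℝ) ^ (k - 1) * T := by rw [hT]; ring
      _ ≤ _ := by gcongr; exact hpow _
  have h6 : 1 + ((M : ℝ) ^ M) ^ (k - 1) * (R ^ 2) ^ (M - 1) ≤ (2 ^ k) ^ M * T := by
    have h7 : (2 : ℝ) * (2 ^ (k - 1)) ^ M ≤ (2 ^ k) ^ M := by
      have : (2 : ℝ) ^ k = 2 * 2 ^ (k - 1) := by rw [← pow_succ']; congr 1; omega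
      rw [this, mul_pow]
      refine mul_le_mul_of_nonneg_right (le_self_pow₀ one_le_two (by omega)) (by positivity)
    have h8 : (1 : ℝ) ≤ (2 ^ (k - 1)) ^ M := one_le_pow₀ (one_le_pow₀ one_le_two)
    calc _ ≤ (2 ^ (k - 1)) ^ M * T + (2 ^ (k - 1)) ^ M * T :=
          add_le_add (one_le_mul_of_one_le_of_one_le h8 h3) h4
      _ = (2 * (2 ^ (k - 1)) ^ M) * T := by ring
      _ ≤ _ := by gcongr
  have h9 : (M : ℝ) ^ (k * M) = (M : ℝ) ^ M * ((M : ℝ) ^ M) ^ (k - 1) := by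
    rw [← pow_succ', ← pow_mul]
    congr 1
    rw [Nat.sub_add_cancel (by omega), mul_comm]
  calc 4 ^ M * momentBound k M R
      ≤ 4 ^ M * (((k : ℝ) ^ k) ^ (2 * M) * ((3 * M) ^ M *
        ((64 ^ M) ^ (k - 1) * ((2 ^ k) ^ M * T)))) := by
        unfold momentBound; gcongr
    _ = _ := by
        rw [h9, hT, pow_mul _ 2 M, mul_pow 3 (M : ℝ), pow_right_comm (64 : ℝ), mul_pow, mul_pow,
          mul_pow, mul_pow]
        ring

end WienerIto

end

theorem mainTheorem2 (k : ℕ) (hk : 2 ≤ k) :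
    ∃ C : ℝ, 0 < C ∧
      ∀ {X Ω : Type*} [MeasurableSpace X] [MeasurableSpace Ω]
        (μ : Measure X) [SigmaFinite μ] (_hμ : WienerIto.IsNonatomic μ)
        (P : Measure Ω) [IsProbabilityMeasure P]
        (W : WienerIto.FiniteMeasureSet μ → Ω → ℝ) (_hW : WienerIto.IsWhiteNoise μ P W)
        (f : (Fin k → X) → ℝ) (_hf : Measurable f)
        (_hf2 : MemLp f 2 (Measure.pi fun _ : Fin k => μ))
        (I : Ω → ℝ) (_hI : WienerIto.IsWienerItoIntegral P W f I)
        (M : ℕ) (_hM : 1 ≤ M) (R : ℝ) (_hR0 : 0 ≤ R) (_hR1 : R ≤ 1)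
        (_hV : ∀ s : ℕ, 1 ≤ s → s ≤ k → WienerIto.V μ s f ≤ ((R ^ (s - 1) : ℝ) : EReal))
        (_hRM : (M : ℝ) ^ (-((k : ℝ) - 1) / 2) ≤ R),
        Integrable (fun ω => ((k.factorial : ℝ) * I ω) ^ (2 * M)) P ∧
          ∫ ω, ((k.factorial : ℝ) * I ω) ^ (2 * M) ∂P
            ≤ C ^ M * (M : ℝ) ^ (k * M) * R ^ (2 * M) := by
  have hk0 : (0 : ℝ) < k := by exact_mod_cast (by omega : 0 < k)
  refine ⟨4 * (k ^ k) ^ 2 * 3 * 64 ^ (k - 1) * 2 ^ k, by positivity, ?_⟩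
  intro X Ω _ _ μ _ _ P _ W hW f _ hf2 I hI M hM R hR0 _ hV hRM
  obtain ⟨hI2, φ, hφf, hφI⟩ := hI
  have hM0 : (0 : ℝ) < M := by exact_mod_cast hM
  have hR : 0 < R := (Real.rpow_pos_of_pos hM0 _).trans_le hRM
  have hV1 : WienerIto.V μ 1 f ≤ ((1 : ℝ) : EReal) := by
    simpa using hV 1 le_rfl (by omega)
  have hV2 : WienerIto.V μ 2 f ≤ ((R : ℝ) : EReal) := by
    simpa using hV 2 (by omega) hk
  set B : ℝ := (4 * (k ^ k) ^ 2 * 3 * 64 ^ (k - 1) * 2 ^ k : ℝ) ^ M * (M : ℝ) ^ (k * M) *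
    R ^ (2 * M) with hB
  have hbound : ∫⁻ ω, ENNReal.ofReal (((k.factorial : ℝ) * I ω) ^ (2 * M)) ∂P ≤
      ENNReal.ofReal B := by
    refine WienerIto.lintegral_pow_le_of_tendsto (2 * M) (k.factorial : ℝ)
      (fun n => hW.aestronglyMeasurable_integral (φ n)) hI2.1 hφI ?_
    -- An error of at most min(1, R) at most doubles both bounds: 1 + ε ≤ 2 and R + ε ≤ 2R. This
    -- needs R > 0, which follows from its lower bound.
    have hε : (0 : ENNReal) < ENNReal.ofReal (min 1 R) :=
      ENNReal.ofReal_pos.2 (lt_min one_pos hR)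
    filter_upwards [hφf.eventually (ge_mem_nhds hε)] with n hn
    have hb := (φ n).hasBlockBounds hk hf2 (le_min zero_le_one hR.le) (min_le_left _ _)
      (min_le_right _ _) hV1 hV2 hn
    exact (hW.lintegral_integral_pow_le hk (φ n) hb hM).trans
      (ENNReal.ofReal_le_ofReal (WienerIto.momentBound_le hk hM hR hRM))
  have hnn : ∀ ω, 0 ≤ ((k.factorial : ℝ) * I ω) ^ (2 * M) := fun ω => (even_two_mul M).pow_nonneg _
  have hmeas : AEStronglyMeasurable (fun ω => ((k.factorial : ℝ) * I ω) ^ (2 * M)) P :=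
    (hI2.1.const_mul _).pow _
  have hint : Integrable (fun ω => ((k.factorial : ℝ) * I ω) ^ (2 * M)) P :=
    ⟨hmeas, (hasFiniteIntegral_iff_ofReal (Filter.Eventually.of_forall hnn)).2
      (hbound.trans_lt ENNReal.ofReal_lt_top)⟩
  refine ⟨hint, ?_⟩
  rw [← ofReal_integral_eq_lintegral_ofReal hint (Filter.Eventually.of_forall hnn)] at hbound
  exact (ENNReal.ofReal_le_ofReal_iff (by positivity)).1 hbound
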